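/- Let $k,R>0$ with $kR\ge 2$. Let $u$ be a radiating solution of the Helmholtz equation outside the ball $B_R\subset\mathbb R^3$: $u\in C^2$ and $(\Delta+k^2)u=0$ in $\{|x|>R\}$, and $r(\partial_r u-iku)(x)\to0$ as $r=|x|\to\infty$; assume that $u$ has boundary values in $L^2(\partial B_R)$, i.e. $u(R\,\cdot)\in L^2(S^2)$ and $u(r\,\cdot)\to u(R\,\cdot)$ in $L^2(S^2)$ as $r\downarrow R$ (this holds for example if $u$ is continuous on $\{|x|\ge R\}$). Let $A$ be its scattering amplitude, $u(r\sigma)=\frac{e^{ikr}}{r}A(\sigma)+O(r^{-2})$ as $r\to\infty$, uniformly in $\sigma\in S^2$. Let $(Y_n^m)_{n\ge0,\,-n\le m\le n}$ be an orthonormal basis of $L^2(S^2)$ formed of spherical harmonics ($Y_n^m$ of degree $n$). For a function $f$ on $S^2$ with coefficients $f_{m,n}=\int_{S^2} f\,\overline{Y_n^m}\,d\sigma$ put $|f_n|^2=\sum_{m=-n}^n|f_{m,n}|^2$. Write $|a_n|^2$ for these quantities for $f=A$ and $|u_n(R)|^2$ for $f=u(R\,\cdot)$, and set $$\|u\|^2_{(l)}(\partial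 B_R)=R^2\sum_{j=0}^{l}\sum_{n=0}^\infty\Big(\frac nR\Big)^{2j}|u_n(R)|^2\in[0,\infty],\qquad M_1=\|u\|_{(1)}(\partial B_R),$$ $$N=\lfloor\sqrt{kR}\rfloor,\qquad \varepsilon_1=\Big(\sum_{n\le N}|a_n|^2\Big)^{1/2},\qquad \varepsilon_2=\Big(\sum_{n>N}|a_n|^2\Big)^{1/2},\qquad E=-\log\varepsilon_2 .$$ Assume $\varepsilon_2\le1$, so that $E\in[0,\infty]$ (if $\varepsilon_2=0$, then $E=\infty$ and the terms $R^2M_1^2/(E+k)$ below are $0$). Then $$\|u\|^2_{(0)}(\partial B_R)\le\frac{2e^2}{\pi}\varepsilon_1^2+\frac2\pi e^{2/R}\varepsilon_2+R^2\frac{M_1^2}{E+k}$$ and $$\|u\|^2_{(0)}(\partial B_R)\le\frac{2e^2}{\pi}\varepsilon_1^2+\sqrt{\frac{2R}{\pi k}}\,e^{1/R}M_1\varepsilon_2^{1/2}+R^2\frac{M_1^2}{E+k}.$$ -/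

import Mathlib

open MeasureTheory Filter Topology
open scoped ENNReal ComplexConjugate

/-- Three-dimensional Euclidean space. -/
abbrev E3 : Type := EuclideanSpace ℝ (Fin 3)

/-- The unit sphere of `E3`. -/
abbrev S2 : Type := Metric.sphere (0 : E3) 1

/-- The surface measure of the unit sphere (total mass `4 * π`). -/
noncomputable abbrev surf : Measure S2 := (volume : Measure E3).toSphere

/-- `u` is a radiating solution of the Helmholtz equation in `{x | R < ‖x‖}`:
`u` is `C²` there, satisfies `Δ u + k² u = 0` there, and satisfies the Sommerfeld radiation
condition `r (∂_r u - i k u) → 0` as `r = ‖x‖ → ∞`. -/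
structure IsRadiatingSolution (k R : ℝ) (u : E3 → ℂ) : Prop where
  contDiffOn : ContDiffOn ℝ 2 u {x | R < ‖x‖}
  helmholtz : ∀ x : E3, R < ‖x‖ → Laplacian.laplacian u x + (k : ℂ) ^ 2 * u x = 0
  sommerfeld : Tendsto
    (fun x : E3 => (‖x‖ : ℂ) * (fderiv ℝ u x (‖x‖⁻¹ • x) - Complex.I * k * u x))
    (Bornology.cobounded E3) (𝓝 0)

/-- The values of `u` on the sphere of radius `R` are square integrable and are its boundary
values from outside, as limits in `L²`. (If `u` is continuous on `{x | R ≤ ‖x‖}`, this holds.) -/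
structure HasL2BoundaryValues (R : ℝ) (u : E3 → ℂ) : Prop where
  memLp : MemLp (fun σ : S2 => u (R • (σ : E3))) 2 surf
  tendsto : Tendsto (fun r : ℝ => eLpNorm (fun σ : S2 => u (r • (σ : E3)) - u (R • (σ : E3))) 2 surf)
    (𝓝[>] R) (𝓝 0)

/-- `A` is the scattering amplitude of `u`:
`u (r σ) = (e ^ (i k r) / r) A σ + O(r⁻²)` as `r → ∞`, uniformly in the direction `σ`. -/
def IsScatteringAmplitude (k : ℝ) (u : E3 → ℂ) (A : S2 → ℂ) : Prop :=
  ∃ C ρ : ℝ, 0 < ρ ∧ ∀ r : ℝ, ρ ≤ r → ∀ σ : S2,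
    ‖u (r • (σ : E3)) - Complex.exp (Complex.I * k * r) / r * A σ‖ ≤ C / r ^ 2

/-- A spherical harmonic of degree `n`: the restriction to the unit sphere of a harmonic
homogeneous polynomial of degree `n` in three variables. -/
def IsSphericalHarmonic (n : ℕ) (f : S2 → ℂ) : Prop :=
  ∃ p : MvPolynomial (Fin 3) ℂ, p.IsHomogeneous n ∧
    ∑ i : Fin 3, MvPolynomial.pderiv i (MvPolynomial.pderiv i p) = 0 ∧
    ∀ σ : S2, f σ = MvPolynomial.eval (fun i => ((σ : E3) i : ℂ)) p

/-- An orthonormal system of spherical harmonics `Y n m`, with `2 n + 1` members in each degree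
`n` (the index `m : Fin (2 * n + 1)` stands for `m = -n, …, n`). The spherical harmonics of degree
`n` form a space of dimension `2 n + 1`, so such a system is a complete orthonormal basis of `L²` of
the sphere. -/
structure IsSphericalHarmonicBasis (Y : (n : ℕ) → Fin (2 * n + 1) → S2 → ℂ) : Prop where
  harmonic : ∀ n m, IsSphericalHarmonic n (Y n m)
  normalized : ∀ n m, ∫ σ, Y n m σ * conj (Y n m σ) ∂surf = 1
  orthogonal : ∀ n m n' m', (⟨n, m⟩ : Σ n : ℕ, Fin (2 * n + 1)) ≠ ⟨n', m'⟩ →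
    ∫ σ, Y n m σ * conj (Y n' m' σ) ∂surf = 0

/-- `|f_n|² = ∑ₘ |f_{m,n}|²`, where `f_{m,n}` are the coefficients of `f` with respect
to `Y n m`. -/
noncomputable def degreeSq (Y : (n : ℕ) → Fin (2 * n + 1) → S2 → ℂ) (f : S2 → ℂ) (n : ℕ) : ℝ≥0∞ :=
  ∑ m : Fin (2 * n + 1), ‖∫ σ, f σ * conj (Y n m σ) ∂surf‖ₑ ^ 2

/-- `ε₁ = (∑_{n ≤ N} |a_n|²) ^ (1/2)`. -/
noncomputable def lowPart (Y : (n : ℕ) → Fin (2 * n + 1) → S2 → ℂ) (A : S2 → ℂ) (N : ℕ) : ℝ≥0∞ :=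
  (∑ n ∈ Finset.range (N + 1), degreeSq Y A n) ^ (1 / 2 : ℝ)

/-- `ε₂ = (∑_{n > N} |a_n|²) ^ (1/2)`. -/
noncomputable def highPart (Y : (n : ℕ) → Fin (2 * n + 1) → S2 → ℂ) (A : S2 → ℂ) (N : ℕ) : ℝ≥0∞ :=
  (∑' n : ℕ, degreeSq Y A (N + 1 + n)) ^ (1 / 2 : ℝ)

/-- The norm `‖u‖_(l)(∂B_R)`, with
`‖u‖²_(l)(∂B_R) = R² ∑_{j ≤ l} ∑_n (n / R) ^ (2 j) |u_n(R)|²`,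
where `|u_n(R)|²` belongs to the expansion of `σ ↦ u (R σ)` in spherical harmonics.
The value `∞` means that the series diverges. -/
noncomputable def sphereNorm (Y : (n : ℕ) → Fin (2 * n + 1) → S2 → ℂ) (l : ℕ) (R : ℝ)
    (u : E3 → ℂ) : ℝ≥0∞ :=
  (ENNReal.ofReal (R ^ 2) * ∑ j ∈ Finset.range (l + 1), ∑' n : ℕ,
    ENNReal.ofReal ((n / R) ^ (2 * j)) * degreeSq Y (fun σ => u (R • (σ : E3))) n) ^ (1 / 2 : ℝ)

/-- `-log ε` for `0 ≤ ε ≤ 1`, with the value `∞` at `ε = 0`. -/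
noncomputable def negLog (ε : ℝ≥0∞) : ℝ≥0∞ := (-ENNReal.log ε).toENNReal

/-! Let v(r) be r times the coefficient of u(r·) against a spherical harmonic of degree n. The
angular part of the Laplacian is a sum of squares of infinitesimal rotations, so it is symmetric on
the sphere and acts on the harmonic as -n(n+1). Hence v'' = (n(n+1)/r² - k²) v (`radialCoeff_ode`),
and the conditions at infinity make v outgoing (`IsRadiatingSolution.isOutgoing`). Wronskians force
v = a H_n (`IsOutgoing.eq_mul_riccatiHankel`), where H_n is the Riccati–Hankel function asymptotic
to e^{ikr} and a is the coefficient of A. As r ↓ R this gives R²|u_n(R)|² = |H_n(R)|²|a_n|²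
(`degreeSq_boundary`). Since H_n is e^{ikr} times a polynomial in 1/r dominated by an exponential
series, |H_n(R)|² ≤ exp(n(n+1)/(kR)) (`norm_riccatiHankel_sq_le`).

The sum over degrees is then split in three (`tsum_le_of_split`). For n ≤ N one has n² ≤ kR and the
exponential is bounded (`exp_le_of_sq_le`): this is the ε₁ term. For n > N with R² + n² ≥ E + k, the
quantity R²|u_n|² is at most R²/(E+k) times its share (R²+n²)|u_n|² of M₁². In the remaining degrees
ε₂ = e^{-E} is small enough to absorb the growth: |H_n|² ε₂ ≤ (2/π)e^{2/R} (`exp_mul_exp_neg_le`).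
Their sum T is thus at most (2/π)e^{2/R} ε₂, which is the first estimate. Also kR·T ≤ R²M₁² because
n² > kR, and the geometric mean of the two bounds on T is the second estimate
(`ENNReal.le_mul_rpow_half_of_le`). -/

/-! ### Rotation invariance of the surface measure -/

/-- Differentiation under the integral over the unit sphere. -/
theorem hasDerivAt_integral_surf {F F' : ℝ → S2 → ℂ} {s : Set ℝ} (hs : IsOpen s) {t₀ : ℝ}
    (ht₀ : t₀ ∈ s) (hF : ∀ t ∈ s, Continuous (F t))
    (hF' : ContinuousOn (fun p : ℝ × S2 => F' p.1 p.2) (s ×ˢ Set.univ))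
    (hd : ∀ t ∈ s, ∀ σ, HasDerivAt (fun t => F t σ) (F' t σ) t) :
    HasDerivAt (fun t => ∫ σ, F t σ ∂surf) (∫ σ, F' t₀ σ ∂surf) t₀ := by
  obtain ⟨ε, hε, hεs⟩ := Metric.nhds_basis_closedBall.mem_iff.1 (hs.mem_nhds ht₀)
  have hK : IsCompact (Metric.closedBall t₀ ε ×ˢ (Set.univ : Set S2)) :=
    (isCompact_closedBall t₀ ε).prod isCompact_univ
  obtain ⟨C, hC⟩ := hK.exists_bound_of_continuousOn
    (hF'.mono (Set.prod_mono_left hεs))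
  have hint : ∀ {g : S2 → ℂ}, Continuous g → Integrable g surf := fun hg =>
    hg.integrable_of_hasCompactSupport (HasCompactSupport.of_compactSpace _)
  have hF't : Continuous (F' t₀) := by
    have : Continuous fun σ : S2 => (t₀, σ) := by fun_prop
    exact hF'.comp_continuous this fun σ => ⟨ht₀, trivial⟩
  refine (hasDerivAt_integral_of_dominated_loc_of_deriv_le (bound := fun _ => C)
    (Metric.closedBall_mem_nhds t₀ hε) ?_ (hint (hF t₀ ht₀)) hF't.aestronglyMeasurable
    (Eventually.of_forall fun σ t ht => hC (t, σ) ⟨ht, trivial⟩) (integrable_const C)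
    (Eventually.of_forall fun σ t ht => hd t (hεs ht) σ)).2
  filter_upwards [hs.mem_nhds ht₀] with t ht using (hF t ht).aestronglyMeasurable

/-- The action of a linear isometry on the unit sphere. -/
noncomputable def sphereMap (e : E3 ≃ₗᵢ[ℝ] E3) (σ : S2) : S2 :=
  ⟨e σ, by simp⟩

@[simp] theorem coe_sphereMap (e : E3 ≃ₗᵢ[ℝ] E3) (σ : S2) : (sphereMap e σ : E3) = e σ := rfl

theorem continuous_sphereMap (e : E3 ≃ₗᵢ[ℝ] E3) : Continuous (sphereMap e) := by
  unfold sphereMap; fun_prop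

/-- The surface measure is invariant under linear isometries. -/
theorem measurePreserving_sphereMap (e : E3 ≃ₗᵢ[ℝ] E3) :
    MeasurePreserving (sphereMap e) surf surf := by
  refine ⟨(continuous_sphereMap e).measurable, ?_⟩
  ext s hs
  -- Surface measure is a multiple of the volume of the cone over the set, so the invariance of
  -- Lebesgue measure carries over.
  rw [Measure.map_apply (continuous_sphereMap e).measurable hs, Measure.toSphere_apply' _ hs,
    Measure.toSphere_apply' _ ((continuous_sphereMap e).measurable hs),
    ← (e.symm.measurePreserving).measure_preimage_equiv (f := e.symm.toMeasurableEquiv)]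
  congr 2
  ext x
  simp only [Set.mem_smul, Set.mem_image, Set.mem_preimage]
  constructor
  · rintro ⟨t, ht, y, ⟨σ, hσ, rfl⟩, h⟩
    refine ⟨t, ht, _, ⟨_, hσ, rfl⟩, ?_⟩
    apply e.symm.injective
    simpa using h
  · rintro ⟨t, ht, y, ⟨σ, hσ, rfl⟩, rfl⟩
    refine ⟨t, ht, _, ⟨sphereMap e.symm σ, ?_, rfl⟩, by simp⟩
    convert hσ
    ext1
    simp

theorem integral_surf_comp_sphereMap (e : E3 ≃ₗᵢ[ℝ] E3) {f : S2 → ℂ} (hf : Continuous f) :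
    ∫ σ, f (sphereMap e σ) ∂surf = ∫ σ, f σ ∂surf := by
  have h := measurePreserving_sphereMap e
  conv_rhs => rw [← h.map_eq]
  rw [integral_map h.measurable.aemeasurable hf.aestronglyMeasurable]

theorem exp_smul_mem_unitary {A : E3 →L[ℝ] E3} (hA : A ∈ skewAdjoint (E3 →L[ℝ] E3)) (t : ℝ) :
    NormedSpace.exp (t • A) ∈ unitary (E3 →L[ℝ] E3) :=
  letI := NormedAlgebra.restrictScalars ℚ ℝ (E3 →L[ℝ] E3)
  NormedSpace.exp_mem_unitary_of_mem_skewAdjoint (skewAdjoint.smul_mem t hA)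

/-- The one-parameter group of isometries generated by a skew-adjoint operator. -/
noncomputable def skewFlow {A : E3 →L[ℝ] E3} (hA : A ∈ skewAdjoint (E3 →L[ℝ] E3)) (t : ℝ) :
    E3 ≃ₗᵢ[ℝ] E3 :=
  Unitary.linearIsometryEquiv ⟨NormedSpace.exp (t • A), exp_smul_mem_unitary hA t⟩

theorem skewFlow_apply {A : E3 →L[ℝ] E3} (hA : A ∈ skewAdjoint (E3 →L[ℝ] E3)) (t : ℝ) (x : E3) :
    skewFlow hA t x = NormedSpace.exp (t • A) x := rfl

theorem hasDerivAt_skewFlow {A : E3 →L[ℝ] E3} (hA : A ∈ skewAdjoint (E3 →L[ℝ] E3)) (t : ℝ)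
    (x : E3) : HasDerivAt (fun t => skewFlow hA t x) (A (skewFlow hA t x)) t := by
  have h := (hasDerivAt_exp_smul_const' (𝕂 := ℝ) A t).clm_apply (hasDerivAt_const t x)
  simpa [skewFlow_apply] using h

theorem isOpen_exterior (R : ℝ) : IsOpen {x : E3 | R < ‖x‖} :=
  isOpen_lt continuous_const continuous_norm

theorem norm_smul_coe_sphere {r : ℝ} (hr : 0 ≤ r) (σ : S2) : ‖r • (σ : E3)‖ = r := by
  simp [norm_smul, abs_of_nonneg hr]

theorem ContinuousOn.comp_smul_sphere {X : Type*} [TopologicalSpace X] {R r : ℝ} {f : E3 → X}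
    (hf : ContinuousOn f {x | R < ‖x‖}) (hR : 0 ≤ R) (hr : R < r) :
    Continuous fun σ : S2 => f (r • (σ : E3)) := by
  refine hf.comp_continuous (by fun_prop) fun σ => ?_
  simpa [norm_smul_coe_sphere (hR.trans hr.le)] using hr

/-- Infinitesimal rotation invariance of the surface measure. -/
theorem integral_surf_fderiv_skewAdjoint {A : E3 →L[ℝ] E3}
    (hA : A ∈ skewAdjoint (E3 →L[ℝ] E3)) {R r : ℝ} (hR : 0 ≤ R) (hr : R < r) {f : E3 → ℂ}
    (hf : ContDiffOn ℝ 1 f {x | R < ‖x‖}) :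
    ∫ σ : S2, fderiv ℝ f (r • (σ : E3)) (A (r • (σ : E3))) ∂surf = 0 := by
  have hr0 : 0 < r := hR.trans_lt hr
  have hmem : ∀ (t : ℝ) (σ : S2), r • skewFlow hA t σ ∈ {x : E3 | R < ‖x‖} := fun t σ => by
    simpa [norm_smul, abs_of_pos hr0] using hr
  have hcont : Continuous fun p : ℝ × S2 => r • skewFlow hA p.1 p.2 := by
    simp only [skewFlow_apply]
    have : Continuous fun t : ℝ => NormedSpace.exp (t • A) :=
      continuous_iff_continuousAt.2 fun t =>
        (hasDerivAt_exp_smul_const (𝕂 := ℝ) A t).continuousAt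
    have h2 : Continuous fun p : ℝ × S2 => NormedSpace.exp (p.1 • A) (p.2 : E3) :=
      (this.comp continuous_fst).clm_apply (by fun_prop)
    exact h2.const_smul r
  have hdf : ContinuousOn (fderiv ℝ f) {x | R < ‖x‖} :=
    hf.continuousOn_fderiv_of_isOpen (isOpen_exterior R) le_rfl
  have key := hasDerivAt_integral_surf (F := fun t σ => f (r • skewFlow hA t σ))
    (F' := fun t σ => fderiv ℝ f (r • skewFlow hA t σ) (r • A (skewFlow hA t σ)))
    (s := Set.univ) isOpen_univ (t₀ := 0) trivial ?_ ?_ ?_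
  -- The integral over the rotated sphere is constant in t; its derivative at t = 0 is the integral
  -- in question.
  · have hconst : (fun t : ℝ => ∫ σ, f (r • skewFlow hA t σ) ∂surf)
        = fun _ => ∫ σ : S2, f (r • (σ : E3)) ∂surf := by
      ext t
      exact integral_surf_comp_sphereMap (skewFlow hA t) (f := fun σ => f (r • (σ : E3)))
        (hf.continuousOn.comp_smul_sphere hR hr)
    rw [hconst] at key
    have := key.unique (hasDerivAt_const _ _)
    have h0 : skewFlow hA 0 = LinearIsometryEquiv.refl ℝ E3 := by
      have : (0 : ℝ) • A = 0 := zero_smul ℝ A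
      ext1 x
      rw [skewFlow_apply, this, NormedSpace.exp_zero]
      rfl
    simpa [h0] using this
  · intro t _
    exact hf.continuousOn.comp_continuous
      (hcont.comp (by fun_prop : Continuous fun σ : S2 => (t, σ))) (hmem t)
  · apply Continuous.continuousOn
    refine (hdf.comp_continuous hcont fun p => hmem p.1 p.2).clm_apply ?_
    simpa [Function.comp_def] using A.continuous.comp hcont
  · intro t _ σ
    have h1 : HasFDerivAt f _ (r • skewFlow hA t σ) :=
      ((hf.differentiableOn one_ne_zero).differentiableAt
        ((isOpen_exterior R).mem_nhds (hmem t σ))).hasFDerivAt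
    exact h1.comp_hasDerivAt t ((hasDerivAt_skewFlow hA t σ).const_smul r)

/-! ### Infinitesimal rotations and the polar form of the Laplacian -/

/-- The derivative of `f` along the linear vector field `A`. -/
noncomputable def lieDeriv (A : E3 →L[ℝ] E3) (f : E3 → ℂ) (x : E3) : ℂ := fderiv ℝ f x (A x)

theorem ContDiffOn.lieDeriv {A : E3 →L[ℝ] E3} {f : E3 → ℂ} {R : ℝ}
    (hf : ContDiffOn ℝ 2 f {x | R < ‖x‖}) : ContDiffOn ℝ 1 (lieDeriv A f) {x | R < ‖x‖} :=
  (hf.fderiv_of_isOpen (isOpen_exterior R) (m := 1) (by norm_num)).clm_apply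
    A.contDiff.contDiffOn

/-- The first-order term arises because the vector field A x itself is differentiated. -/
theorem lieDeriv_lieDeriv {A : E3 →L[ℝ] E3} {f : E3 → ℂ} {x : E3} (hf : ContDiffAt ℝ 2 f x) :
    lieDeriv A (lieDeriv A f) x =
      fderiv ℝ (fderiv ℝ f) x (A x) (A x) + fderiv ℝ f x (A (A x)) := by
  have h1 : DifferentiableAt ℝ (fderiv ℝ f) x :=
    (hf.fderiv_right (m := 1) (by norm_num)).differentiableAt one_ne_zero
  have h := (h1.hasFDerivAt.clm_apply A.hasFDerivAt).fderiv
  rw [lieDeriv]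
  change fderiv ℝ (fun y => fderiv ℝ f y (A y)) x (A x) = _
  rw [h]
  simp [add_comm]

/-- Integration by parts: the derivative of the product f g along a rotation field has mean zero on
the sphere. -/
theorem integral_lieDeriv_mul {A : E3 →L[ℝ] E3} (hA : A ∈ skewAdjoint (E3 →L[ℝ] E3))
    {R r : ℝ} (hR : 0 ≤ R) (hr : R < r) {f g : E3 → ℂ} (hf : ContDiffOn ℝ 1 f {x | R < ‖x‖})
    (hg : ContDiffOn ℝ 1 g {x | R < ‖x‖}) :
    ∫ σ : S2, lieDeriv A f (r • (σ : E3)) * g (r • (σ : E3)) ∂surf =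
      -∫ σ : S2, f (r • (σ : E3)) * lieDeriv A g (r • (σ : E3)) ∂surf := by
  have h := integral_surf_fderiv_skewAdjoint hA hR hr (hf.mul hg)
  have hint : ∀ {g : S2 → ℂ}, Continuous g → Integrable g surf := fun hg =>
    hg.integrable_of_hasCompactSupport (HasCompactSupport.of_compactSpace _)
  have hL : ∀ {f : E3 → ℂ}, ContDiffOn ℝ 1 f {x | R < ‖x‖} →
      ContinuousOn (lieDeriv A f) {x | R < ‖x‖} := fun hf =>
    (hf.continuousOn_fderiv_of_isOpen (isOpen_exterior R) le_rfl).clm_apply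
      A.continuous.continuousOn
  have hi1 := hint (((hL hf).mul hg.continuousOn).comp_smul_sphere hR hr)
  have hi2 := hint ((hf.continuousOn.mul (hL hg)).comp_smul_sphere hR hr)
  simp only [Pi.mul_apply] at hi1 hi2
  rw [eq_neg_iff_add_eq_zero, ← integral_add hi1 hi2, ← h]
  congr 1
  ext σ
  have hx : {x : E3 | R < ‖x‖} ∈ 𝓝 (r • (σ : E3)) := (isOpen_exterior R).mem_nhds
    (by simpa [norm_smul_coe_sphere (hR.trans hr.le)] using hr)
  have h1 := ((hf.differentiableOn one_ne_zero).differentiableAt hx)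
  have h2 := ((hg.differentiableOn one_ne_zero).differentiableAt hx)
  rw [fderiv_fun_mul h1 h2]
  simp [lieDeriv]
  ring

theorem integral_lieDeriv_lieDeriv_mul {A : E3 →L[ℝ] E3} (hA : A ∈ skewAdjoint (E3 →L[ℝ] E3))
    {R r : ℝ} (hR : 0 ≤ R) (hr : R < r) {f g : E3 → ℂ} (hf : ContDiffOn ℝ 2 f {x | R < ‖x‖})
    (hg : ContDiffOn ℝ 2 g {x | R < ‖x‖}) :
    ∫ σ : S2, lieDeriv A (lieDeriv A f) (r • (σ : E3)) * g (r • (σ : E3)) ∂surf =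
      ∫ σ : S2, f (r • (σ : E3)) * lieDeriv A (lieDeriv A g) (r • (σ : E3)) ∂surf := by
  rw [integral_lieDeriv_mul hA hR hr hf.lieDeriv (hg.of_le one_le_two),
    integral_lieDeriv_mul hA hR hr (hf.of_le one_le_two) hg.lieDeriv, neg_neg]

/-- The infinitesimal rotation about the `i`-th coordinate axis. -/
noncomputable def axisRotation (i : Fin 3) : E3 →L[ℝ] E3 :=
  Matrix.toEuclideanCLM (n := Fin 3) (𝕜 := ℝ)
    (![!![0, 0, 0; 0, 0, -1; 0, 1, 0], !![0, 0, 1; 0, 0, 0; -1, 0, 0],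
      !![0, -1, 0; 1, 0, 0; 0, 0, 0]] i)

theorem axisRotation_mem_skewAdjoint (i : Fin 3) :
    axisRotation i ∈ skewAdjoint (E3 →L[ℝ] E3) := by
  rw [skewAdjoint.mem_iff, axisRotation, ← map_star, ← map_neg]
  congr 1
  ext a b
  fin_cases i <;> fin_cases a <;> fin_cases b <;> simp [Matrix.star_apply]

theorem axisRotation_apply (x : E3) :
    axisRotation 0 x = x 1 • EuclideanSpace.single 2 (1 : ℝ) - x 2 • EuclideanSpace.single 1 (1 : ℝ) ∧
    axisRotation 1 x = x 2 • EuclideanSpace.single 0 (1 : ℝ) - x 0 • EuclideanSpace.single 2 (1 : ℝ) ∧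
    axisRotation 2 x = x 0 • EuclideanSpace.single 1 (1 : ℝ) - x 1 • EuclideanSpace.single 0 (1 : ℝ) := by
  refine ⟨?_, ?_, ?_⟩ <;>
  · ext i
    fin_cases i <;> simp [axisRotation, Matrix.mulVec, dotProduct, Fin.sum_univ_three]

theorem eq_sum_single (x : E3) : x = x 0 • EuclideanSpace.single 0 (1 : ℝ) +
    x 1 • EuclideanSpace.single 1 (1 : ℝ) + x 2 • EuclideanSpace.single 2 (1 : ℝ) := by
  ext i
  fin_cases i <;> simp

/-- The rotation fields at x are e_i × x, so this is the polarized identity |x|²|v|² = (x·v)² + |x ×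
v|²: away from 0, x is the radial direction and the e_i × x span the tangential ones. -/
theorem norm_sq_mul_trace (B : E3 →L[ℝ] E3 →L[ℝ] ℂ) (hB : ∀ x y, B x y = B y x) (x : E3) :
    (‖x‖ ^ 2 : ℂ) * ∑ i : Fin 3, B (EuclideanSpace.single i 1) (EuclideanSpace.single i 1) =
      B x x + ∑ i, B (axisRotation i x) (axisRotation i x) := by
  obtain ⟨h0, h1, h2⟩ := axisRotation_apply x
  have hx : (‖x‖ ^ 2 : ℂ) = (x 0 : ℂ) ^ 2 + (x 1 : ℂ) ^ 2 + (x 2 : ℂ) ^ 2 := by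
    have := EuclideanSpace.real_norm_sq_eq x
    rw [Fin.sum_univ_three] at this
    exact_mod_cast congrArg (Complex.ofReal) this
  have hxx : B x x = B (x 0 • EuclideanSpace.single 0 (1 : ℝ) +
    x 1 • EuclideanSpace.single 1 (1 : ℝ) + x 2 • EuclideanSpace.single 2 (1 : ℝ))
    (x 0 • EuclideanSpace.single 0 (1 : ℝ) +
    x 1 • EuclideanSpace.single 1 (1 : ℝ) + x 2 • EuclideanSpace.single 2 (1 : ℝ)) := by
    rw [← eq_sum_single x]
  rw [hxx, hx]
  simp only [Fin.sum_univ_three, h0, h1, h2, map_add, map_sub, map_smul, add_apply, sub_apply,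
    smul_apply, Complex.real_smul]
  rw [hB (EuclideanSpace.single 1 1) (EuclideanSpace.single 0 1),
    hB (EuclideanSpace.single 2 1) (EuclideanSpace.single 0 1),
    hB (EuclideanSpace.single 2 1) (EuclideanSpace.single 1 1)]
  ring

theorem sum_axisRotation_axisRotation (x : E3) :
    ∑ i, axisRotation i (axisRotation i x) = -(2 : ℝ) • x := by
  have h := fun y => axisRotation_apply y
  rw [Fin.sum_univ_three, (h _).1, (h _).2.1, (h _).2.2, (h x).1, (h x).2.1, (h x).2.2]
  ext i
  fin_cases i <;> simp <;> ring

/-- The Laplacian in polar coordinates. -/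
theorem sum_lieDeriv_lieDeriv {f : E3 → ℂ} {x : E3} (hf : ContDiffAt ℝ 2 f x) :
    ∑ i, lieDeriv (axisRotation i) (lieDeriv (axisRotation i) f) x =
      (‖x‖ ^ 2 : ℂ) * Laplacian.laplacian f x - fderiv ℝ (fderiv ℝ f) x x x
        - 2 * fderiv ℝ f x x := by
  have hB : ∀ y z, fderiv ℝ (fderiv ℝ f) x y z = fderiv ℝ (fderiv ℝ f) x z y :=
    hf.isSymmSndFDerivAt (by simp)
  have hL : Laplacian.laplacian f x = ∑ i : Fin 3, fderiv ℝ (fderiv ℝ f) x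
      (EuclideanSpace.single i 1) (EuclideanSpace.single i 1) := by
    rw [InnerProductSpace.laplacian_eq_iteratedFDeriv_orthonormalBasis f
      (EuclideanSpace.basisFun (Fin 3) ℝ)]
    simp [iteratedFDeriv_two_apply]
  rw [hL, norm_sq_mul_trace _ hB]
  simp only [lieDeriv_lieDeriv hf, Finset.sum_add_distrib]
  rw [← map_sum, sum_axisRotation_axisRotation]
  simp
  ring

/-! ### Homogeneous harmonic polynomials -/

/-- The function on `E3` defined by a polynomial in three variables. -/
noncomputable def polyFun (p : MvPolynomial (Fin 3) ℂ) (x : E3) : ℂ :=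
  MvPolynomial.eval (fun i => (x i : ℂ)) p

/-- The `i`-th coordinate as a complex-valued functional. -/
noncomputable def coordCLM (i : Fin 3) : E3 →L[ℝ] ℂ :=
  Complex.ofRealCLM.comp (EuclideanSpace.proj i)

@[simp] theorem coordCLM_apply (i : Fin 3) (x : E3) : coordCLM i x = (x i : ℂ) := rfl

theorem hasFDerivAt_polyFun (p : MvPolynomial (Fin 3) ℂ) (x : E3) :
    HasFDerivAt (polyFun p) (∑ i, polyFun (MvPolynomial.pderiv i p) x • coordCLM i) x := by
  induction p using MvPolynomial.induction_on with
  | C a =>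
    have : polyFun (MvPolynomial.C a) = fun _ => a := by ext; simp [polyFun]
    rw [this]
    refine (hasFDerivAt_const a x).congr_fderiv ?_
    ext v
    simp [polyFun]
  | add p q hp hq =>
    have : polyFun (p + q) = fun y => polyFun p y + polyFun q y := by ext; simp [polyFun]
    rw [this]
    refine (hp.add hq).congr_fderiv ?_
    ext v
    simp [polyFun, add_mul, Finset.sum_add_distrib]
  | mul_X p j hp =>
    have : polyFun (p * MvPolynomial.X j) = fun y => polyFun p y * coordCLM j y := by
      ext; simp [polyFun]
    rw [this]
    refine (hp.mul (coordCLM j).hasFDerivAt).congr_fderiv ?_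
    ext v
    simp only [polyFun, Derivation.leibniz, MvPolynomial.pderiv_X, map_add, smul_eq_mul, map_mul,
      MvPolynomial.eval_X, Pi.single_apply]
    simp [Fin.sum_univ_three]
    fin_cases j <;> simp <;> ring

theorem fderiv_polyFun (p : MvPolynomial (Fin 3) ℂ) (x v : E3) :
    fderiv ℝ (polyFun p) x v = ∑ i, polyFun (MvPolynomial.pderiv i p) x * (v i : ℂ) := by
  simp [(hasFDerivAt_polyFun p x).fderiv]

theorem contDiff_polyFun (p : MvPolynomial (Fin 3) ℂ) {n : WithTop ℕ∞} :
    ContDiff ℝ n (polyFun p) := by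
  induction p using MvPolynomial.induction_on with
  | C a =>
    have : polyFun (MvPolynomial.C a) = fun _ => a := by ext; simp [polyFun]
    rw [this]
    exact contDiff_const
  | add p q hp hq =>
    have : polyFun (p + q) = fun y => polyFun p y + polyFun q y := by ext; simp [polyFun]
    rw [this]
    exact hp.add hq
  | mul_X p j hp =>
    have : polyFun (p * MvPolynomial.X j) = fun y => polyFun p y * coordCLM j y := by
      ext; simp [polyFun]
    rw [this]
    exact hp.mul (coordCLM j).contDiff

theorem laplacian_polyFun (p : MvPolynomial (Fin 3) ℂ) (x : E3) :
    Laplacian.laplacian (polyFun p) x =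
      polyFun (∑ i : Fin 3, MvPolynomial.pderiv i (MvPolynomial.pderiv i p)) x := by
  rw [InnerProductSpace.laplacian_eq_iteratedFDeriv_orthonormalBasis _
    (EuclideanSpace.basisFun (Fin 3) ℝ)]
  simp only [iteratedFDeriv_two_apply]
  have hsum : polyFun (∑ i : Fin 3, MvPolynomial.pderiv i (MvPolynomial.pderiv i p)) x =
      ∑ i : Fin 3, polyFun (MvPolynomial.pderiv i (MvPolynomial.pderiv i p)) x := by
    simp [polyFun]
  rw [hsum]
  refine Finset.sum_congr rfl fun i _ => ?_
  have hd : DifferentiableAt ℝ (fderiv ℝ (polyFun p)) x :=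
    ((contDiff_polyFun p (n := 2)).fderiv_right (m := 1) (by norm_num)).differentiable one_ne_zero x
  have he : ∀ q : MvPolynomial (Fin 3) ℂ, ∀ y, fderiv ℝ (polyFun q) y (EuclideanSpace.single i 1) =
      polyFun (MvPolynomial.pderiv i q) y := by
    intro q y
    rw [fderiv_polyFun]
    rw [Finset.sum_eq_single i] <;> simp +contextual
  have h1 := (hd.hasFDerivAt.clm_apply
    (hasFDerivAt_const (EuclideanSpace.single i (1 : ℝ)) x)).fderiv
  simp only [he] at h1
  have h2 := congrArg (fun L : E3 →L[ℝ] ℂ => L (EuclideanSpace.single i 1)) h1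
  have h3 := he (MvPolynomial.pderiv i p) x
  rw [← h3]
  simpa using h2.symm

theorem polyFun_smul {p : MvPolynomial (Fin 3) ℂ} {n : ℕ} (hp : p.IsHomogeneous n) (t : ℝ)
    (x : E3) : polyFun p (t • x) = (t : ℂ) ^ n * polyFun p x := by
  simp only [polyFun, MvPolynomial.eval_eq', Finset.mul_sum]
  refine Finset.sum_congr rfl fun d hd => ?_
  have hn : ∑ i, d i = n := by
    rw [← Finsupp.degree_eq_sum, Finsupp.degree_eq_weight_one]
    exact hp (MvPolynomial.mem_support_iff.1 hd)
  simp only [PiLp.smul_apply, smul_eq_mul, Complex.ofReal_mul, mul_pow, Finset.prod_mul_distrib,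
    Finset.prod_pow_eq_pow_sum, hn]
  ring

/-- Euler's identity. -/
theorem fderiv_polyFun_self {p : MvPolynomial (Fin 3) ℂ} {n : ℕ} (hp : p.IsHomogeneous n)
    (x : E3) : fderiv ℝ (polyFun p) x x = n * polyFun p x := by
  have h1 : HasDerivAt (fun t : ℝ => t • x) x 1 := by
    simpa using (hasDerivAt_id (1 : ℝ)).smul_const x
  have h2 : HasFDerivAt (polyFun p) (fderiv ℝ (polyFun p) x) ((1 : ℝ) • x) := by
    rw [one_smul]
    exact ((contDiff_polyFun p (n := 1)).differentiable one_ne_zero x).hasFDerivAt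
  have h3 := h2.comp_hasDerivAt 1 h1
  have h4 : HasDerivAt (fun t : ℝ => (t : ℂ) ^ n * polyFun p x) (n * polyFun p x) 1 := by
    have := ((Complex.ofRealCLM.hasDerivAt (x := (1 : ℝ))).pow n).mul_const (polyFun p x)
    simpa using this
  have h5 : (polyFun p ∘ fun t : ℝ => t • x) = fun t : ℝ => (t : ℂ) ^ n * polyFun p x :=
    funext fun t => polyFun_smul hp t x
  rw [h5] at h3
  exact h3.unique h4

/-- Euler's identity applied twice: with A the identity, `lieDeriv A` multiplies by n, so n² p =
D²p(x, x) + n p. -/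
theorem fderiv_fderiv_polyFun_self {p : MvPolynomial (Fin 3) ℂ} {n : ℕ} (hp : p.IsHomogeneous n)
    (x : E3) : fderiv ℝ (fderiv ℝ (polyFun p)) x x x = (n ^ 2 - n) * polyFun p x := by
  have h := lieDeriv_lieDeriv (A := .id ℝ E3) (x := x)
    (contDiff_polyFun p (n := 2)).contDiffAt
  have h1 : lieDeriv (.id ℝ E3) (polyFun p) = fun x => n * polyFun p x := by
    ext y
    exact fderiv_polyFun_self hp y
  rw [h1, lieDeriv, fderiv_const_mul
    ((contDiff_polyFun p (n := 1)).differentiable one_ne_zero x)] at h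
  simp [fderiv_polyFun_self hp] at h
  linear_combination -h

/-- Harmonic homogeneous polynomials are eigenfunctions of the spherical Laplacian. -/
theorem sum_lieDeriv_lieDeriv_polyFun {p : MvPolynomial (Fin 3) ℂ} {n : ℕ}
    (hp : p.IsHomogeneous n)
    (hh : ∑ i : Fin 3, MvPolynomial.pderiv i (MvPolynomial.pderiv i p) = 0) (x : E3) :
    ∑ i, lieDeriv (axisRotation i) (lieDeriv (axisRotation i) (polyFun p)) x =
      -(n * (n + 1)) * polyFun p x := by
  rw [sum_lieDeriv_lieDeriv (contDiff_polyFun p).contDiffAt, laplacian_polyFun, hh,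
    fderiv_fderiv_polyFun_self hp, fderiv_polyFun_self hp]
  simp [polyFun]
  ring

/-- The pairings below are bilinear, whereas coefficients are taken against the conjugate of Y;
conjugating the polynomial's coefficients bridges the two. -/
theorem IsSphericalHarmonic.conj {n : ℕ} {f : S2 → ℂ} (hf : IsSphericalHarmonic n f) :
    IsSphericalHarmonic n fun σ => conj (f σ) := by
  obtain ⟨p, hp, hh, hpf⟩ := hf
  refine ⟨MvPolynomial.map (starRingEnd ℂ) p, hp.map _, ?_, fun σ => ?_⟩
  · have := congrArg (MvPolynomial.map (starRingEnd ℂ)) hh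
    simpa [MvPolynomial.pderiv_map] using this
  · simp only [hpf]
    rw [MvPolynomial.eval_map, ← MvPolynomial.eval₂_id, MvPolynomial.eval₂_comp_left]
    congr 1
    ext i
    simp

theorem IsSphericalHarmonic.exists_polyFun {n : ℕ} {f : S2 → ℂ} (hf : IsSphericalHarmonic n f) :
    ∃ p : MvPolynomial (Fin 3) ℂ, p.IsHomogeneous n ∧
      ∑ i : Fin 3, MvPolynomial.pderiv i (MvPolynomial.pderiv i p) = 0 ∧
      ∀ σ : S2, f σ = polyFun p σ := hf

theorem IsSphericalHarmonic.continuous {n : ℕ} {f : S2 → ℂ} (hf : IsSphericalHarmonic n f) :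
    Continuous f := by
  obtain ⟨p, -, -, hp⟩ := hf.exists_polyFun
  have : f = fun σ : S2 => polyFun p σ := funext hp
  rw [this]
  exact (contDiff_polyFun p (n := 0)).continuous.comp continuous_subtype_val

theorem Continuous.integrable_surf {f : S2 → ℂ} (hf : Continuous f) : Integrable f surf :=
  hf.integrable_of_hasCompactSupport (HasCompactSupport.of_compactSpace _)

/-! ### The radial equation for the coefficients -/

section radial

variable {R r : ℝ} {u : E3 → ℂ} {g : S2 → ℂ}

theorem smul_sphere_mem_exterior (hR : 0 ≤ R) (hr : R < r) (σ : S2) :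
    r • (σ : E3) ∈ {x : E3 | R < ‖x‖} := by
  simpa [norm_smul_coe_sphere (hR.trans hr.le)] using hr

theorem continuousOn_comp_smul_sphere {X : Type*} [TopologicalSpace X] {f : E3 → X} (hR : 0 ≤ R)
    (hf : ContinuousOn f {x | R < ‖x‖}) :
    ContinuousOn (fun p : ℝ × S2 => f (p.1 • (p.2 : E3))) (Set.Ioi R ×ˢ Set.univ) :=
  hf.comp (by fun_prop) fun p hp => smul_sphere_mem_exterior hR hp.1 p.2

theorem hasDerivAt_radialCoeff (hR : 0 ≤ R) (hr : R < r) (hu : ContDiffOn ℝ 1 u {x | R < ‖x‖})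
    (hg : Continuous g) :
    HasDerivAt (fun r : ℝ => ∫ σ : S2, u (r • (σ : E3)) * g σ ∂surf)
      (∫ σ : S2, fderiv ℝ u (r • (σ : E3)) σ * g σ ∂surf) r := by
  refine hasDerivAt_integral_surf (F := fun r σ => u (r • (σ : E3)) * g σ)
    (F' := fun r σ => fderiv ℝ u (r • (σ : E3)) σ * g σ) isOpen_Ioi hr (fun t ht => ?_) ?_ ?_
  · exact (hu.continuousOn.comp_smul_sphere hR ht).mul hg
  · refine ContinuousOn.mul ?_ (by fun_prop)
    exact (continuousOn_comp_smul_sphere hR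
      (hu.continuousOn_fderiv_of_isOpen (isOpen_exterior R) le_rfl)).clm_apply (by fun_prop)
  · intro t ht σ
    have h1 : HasFDerivAt u _ (t • (σ : E3)) := ((hu.differentiableOn one_ne_zero).differentiableAt
      ((isOpen_exterior R).mem_nhds (smul_sphere_mem_exterior hR ht σ))).hasFDerivAt
    have h2 : HasDerivAt (fun t : ℝ => t • (σ : E3)) σ t := by
      simpa using (hasDerivAt_id t).smul_const (σ : E3)
    exact (h1.comp_hasDerivAt t h2).mul_const (g σ)

theorem hasDerivAt_radialCoeff_deriv (hR : 0 ≤ R) (hr : R < r)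
    (hu : ContDiffOn ℝ 2 u {x | R < ‖x‖}) (hg : Continuous g) :
    HasDerivAt (fun r : ℝ => ∫ σ : S2, fderiv ℝ u (r • (σ : E3)) σ * g σ ∂surf)
      (∫ σ : S2, fderiv ℝ (fderiv ℝ u) (r • (σ : E3)) σ σ * g σ ∂surf) r := by
  have hu' : ContDiffOn ℝ 1 (fderiv ℝ u) {x | R < ‖x‖} :=
    hu.fderiv_of_isOpen (isOpen_exterior R) (by norm_num)
  refine hasDerivAt_integral_surf (F := fun r σ => fderiv ℝ u (r • (σ : E3)) σ * g σ)
    (F' := fun r σ => fderiv ℝ (fderiv ℝ u) (r • (σ : E3)) σ σ * g σ) isOpen_Ioi hr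
    (fun t ht => ?_) ?_ ?_
  · exact ((hu'.continuousOn.comp_smul_sphere hR ht).clm_apply (by fun_prop)).mul hg
  · refine ContinuousOn.mul ?_ (by fun_prop)
    have hσ : ContinuousOn (fun p : ℝ × S2 => (p.2 : E3)) (Set.Ioi R ×ˢ Set.univ) := by fun_prop
    have h1 := continuousOn_comp_smul_sphere hR
      (hu'.continuousOn_fderiv_of_isOpen (isOpen_exterior R) le_rfl)
    have h2 : ContinuousOn (fun p : ℝ × S2 => fderiv ℝ (fderiv ℝ u) (p.1 • (p.2 : E3)) p.2)
      (Set.Ioi R ×ˢ Set.univ) := h1.clm_apply hσ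
    exact h2.clm_apply hσ
  · intro t ht σ
    have h1 : HasFDerivAt (fderiv ℝ u) _ (t • (σ : E3)) :=
      ((hu'.differentiableOn one_ne_zero).differentiableAt
      ((isOpen_exterior R).mem_nhds (smul_sphere_mem_exterior hR ht σ))).hasFDerivAt
    have h2 : HasDerivAt (fun t : ℝ => t • (σ : E3)) σ t := by
      simpa using (hasDerivAt_id t).smul_const (σ : E3)
    have h3 : HasDerivAt (fun t : ℝ => fderiv ℝ u (t • (σ : E3)))
      (fderiv ℝ (fderiv ℝ u) (t • (σ : E3)) σ) t := h1.comp_hasDerivAt t h2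
    have h4 := (h3.clm_apply (hasDerivAt_const t (σ : E3))).mul_const (g σ)
    rwa [map_zero, add_zero] at h4

/-- The spherical Bessel equation for the coefficients of a solution of the Helmholtz equation. -/
theorem radialCoeff_ode {k : ℝ} {n : ℕ} (hR : 0 ≤ R) (hr : R < r)
    (hu : ContDiffOn ℝ 2 u {x | R < ‖x‖})
    (hH : ∀ x : E3, R < ‖x‖ → Laplacian.laplacian u x + (k : ℂ) ^ 2 * u x = 0)
    (hg : IsSphericalHarmonic n g) :
    (r : ℂ) ^ 2 * ∫ σ : S2, fderiv ℝ (fderiv ℝ u) (r • (σ : E3)) σ σ * g σ ∂surf =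
      -2 * r * (∫ σ : S2, fderiv ℝ u (r • (σ : E3)) σ * g σ ∂surf)
      + (n * (n + 1) - (k : ℂ) ^ 2 * r ^ 2) * ∫ σ : S2, u (r • (σ : E3)) * g σ ∂surf := by
  have hgc := hg.continuous
  obtain ⟨p, hp, hh, hpg⟩ := hg.exists_polyFun
  have hr0 : 0 < r := hR.trans_lt hr
  have hq : ContDiffOn ℝ 2 (polyFun p) {x : E3 | R < ‖x‖} := (contDiff_polyFun p).contDiffOn
  have hL : ∀ {f : E3 → ℂ} (i : Fin 3), ContDiffOn ℝ 2 f {x | R < ‖x‖} →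
      ContinuousOn (lieDeriv (axisRotation i) (lieDeriv (axisRotation i) f)) {x | R < ‖x‖} :=
    fun i hf => ((hf.lieDeriv).continuousOn_fderiv_of_isOpen (isOpen_exterior R) le_rfl).clm_apply
      (axisRotation i).continuous.continuousOn
  -- Symmetry moves the angular Laplacian from u onto the homogeneous extension p of g, where it is
  -- multiplication by -n(n+1). Both sides then carry the factor r^n, cancelled at the end.
  have key : ∫ σ : S2, (∑ i, lieDeriv (axisRotation i) (lieDeriv (axisRotation i) u)
        (r • (σ : E3))) * polyFun p (r • (σ : E3)) ∂surf =
      ∫ σ : S2, u (r • (σ : E3)) * (∑ i, lieDeriv (axisRotation i)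
        (lieDeriv (axisRotation i) (polyFun p)) (r • (σ : E3))) ∂surf := by
    simp only [Finset.sum_mul, Finset.mul_sum]
    rw [integral_finsetSum, integral_finsetSum]
    · exact Finset.sum_congr rfl fun i _ => integral_lieDeriv_lieDeriv_mul
        (axisRotation_mem_skewAdjoint i) hR hr hu hq
    · exact fun i _ => (((hu.continuousOn).mul (hL i hq)).comp_smul_sphere hR hr).integrable_surf
    · exact fun i _ => (((hL i hu).mul hq.continuousOn).comp_smul_sphere hR hr).integrable_surf
  have h1 : ∀ σ : S2, (∑ i, lieDeriv (axisRotation i) (lieDeriv (axisRotation i) u)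
        (r • (σ : E3))) * polyFun p (r • (σ : E3)) =
      (r : ℂ) ^ n * (-(k : ℂ) ^ 2 * r ^ 2 * (u (r • (σ : E3)) * g σ)
        - (r : ℂ) ^ 2 * (fderiv ℝ (fderiv ℝ u) (r • (σ : E3)) σ σ * g σ)
        - 2 * r * (fderiv ℝ u (r • (σ : E3)) σ * g σ)) := by
    intro σ
    have hm := smul_sphere_mem_exterior hR hr σ
    rw [sum_lieDeriv_lieDeriv (hu.contDiffAt ((isOpen_exterior R).mem_nhds hm)), polyFun_smul hp,
      ← hpg, eq_neg_of_add_eq_zero_left (hH _ hm), norm_smul_coe_sphere hr0.le]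
    simp
    ring
  have h2 : ∀ σ : S2, u (r • (σ : E3)) * (∑ i, lieDeriv (axisRotation i)
        (lieDeriv (axisRotation i) (polyFun p)) (r • (σ : E3))) =
      (r : ℂ) ^ n * (-(n * (n + 1)) * (u (r • (σ : E3)) * g σ)) := by
    intro σ
    rw [sum_lieDeriv_lieDeriv_polyFun hp hh, polyFun_smul hp, ← hpg]
    ring
  have hu' : ContDiffOn ℝ 1 (fderiv ℝ u) {x | R < ‖x‖} :=
    hu.fderiv_of_isOpen (isOpen_exterior R) (by norm_num)
  have i0 : Integrable (fun σ : S2 => u (r • (σ : E3)) * g σ) surf :=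
    ((hu.continuousOn.comp_smul_sphere hR hr).mul hgc).integrable_surf
  have i1 : Integrable (fun σ : S2 => fderiv ℝ u (r • (σ : E3)) σ * g σ) surf :=
    (((hu'.continuousOn.comp_smul_sphere hR hr).clm_apply (by fun_prop)).mul hgc).integrable_surf
  have i2 : Integrable (fun σ : S2 => fderiv ℝ (fderiv ℝ u) (r • (σ : E3)) σ σ * g σ) surf :=
    (((((hu'.continuousOn_fderiv_of_isOpen (isOpen_exterior R) le_rfl).comp_smul_sphere hR
      hr).clm_apply (by fun_prop)).clm_apply (by fun_prop)).mul hgc).integrable_surf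
  have i3 : Integrable (fun σ : S2 => -(k : ℂ) ^ 2 * r ^ 2 * (u (r • (σ : E3)) * g σ) -
      (r : ℂ) ^ 2 * (fderiv ℝ (fderiv ℝ u) (r • (σ : E3)) σ σ * g σ)) surf :=
    (i0.const_mul _).sub (i2.const_mul _)
  simp only [h1, h2] at key
  rw [integral_const_mul, integral_const_mul, integral_const_mul] at key
  have key := mul_left_cancel₀ (pow_ne_zero n (by exact_mod_cast hr0.ne')) key
  rw [integral_sub i3 (i1.const_mul _),
    integral_sub (i0.const_mul _) (i2.const_mul _), integral_const_mul, integral_const_mul,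
    integral_const_mul] at key
  linear_combination -key

end radial

/-! ### Riccati–Hankel functions -/

/-- Coefficients of the spherical Hankel function of degree `n`. -/
noncomputable def hankelCoeff (k : ℝ) (n : ℕ) : ℕ → ℂ
  | 0 => 1
  | j + 1 => hankelCoeff k n j * ((j * (j + 1) - n * (n + 1)) / (2 * Complex.I * k * (j + 1)))

/-- The factor `P` in the Riccati–Hankel function `exp (i k r) * P (1 / r)`. -/
noncomputable def hankelPoly (k : ℝ) (n : ℕ) (r : ℝ) : ℂ :=
  ∑ j ∈ Finset.range (n + 1), hankelCoeff k n j * (r : ℂ)⁻¹ ^ j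

/-- The derivative of `hankelPoly`. -/
noncomputable def hankelPolyDeriv (k : ℝ) (n : ℕ) (r : ℝ) : ℂ :=
  ∑ j ∈ Finset.range (n + 1), hankelCoeff k n j * (-j * (r : ℂ)⁻¹ ^ (j + 1))

/-- The Riccati–Hankel function of degree `n`, normalized to be asymptotic to `exp (i k r)`. -/
noncomputable def riccatiHankel (k : ℝ) (n : ℕ) (r : ℝ) : ℂ :=
  Complex.exp (Complex.I * k * r) * hankelPoly k n r

/-- The derivative of `riccatiHankel`. -/
noncomputable def riccatiHankelDeriv (k : ℝ) (n : ℕ) (r : ℝ) : ℂ :=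
  Complex.exp (Complex.I * k * r) * (Complex.I * k * hankelPoly k n r + hankelPolyDeriv k n r)

theorem hankelCoeff_succ_mul {k : ℝ} (hk : k ≠ 0) (n j : ℕ) :
    2 * Complex.I * k * (j + 1) * hankelCoeff k n (j + 1) =
      hankelCoeff k n j * (j * (j + 1) - n * (n + 1)) := by
  have hj : (j : ℂ) + 1 ≠ 0 := by exact_mod_cast j.succ_ne_zero
  have hk' : (k : ℂ) ≠ 0 := by exact_mod_cast hk
  rw [hankelCoeff]
  field_simp [Complex.I_ne_zero]

/-- The recursion factor n(n+1) - n(n+1) ends the expansion in 1/r, so P is exactly a polynomial in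
1/r. -/
theorem hankelCoeff_self_succ (k : ℝ) (n : ℕ) : hankelCoeff k n (n + 1) = 0 := by
  simp [hankelCoeff]

theorem hasDerivAt_inv_pow {r : ℝ} (hr : r ≠ 0) (j : ℕ) :
    HasDerivAt (fun r : ℝ => (r : ℂ)⁻¹ ^ j) (-j * (r : ℂ)⁻¹ ^ (j + 1)) r := by
  have hr' : (r : ℂ) ≠ 0 := by exact_mod_cast hr
  have h1 : HasDerivAt (fun r : ℝ => (r : ℂ)⁻¹) (-((r : ℂ) ^ 2)⁻¹) r :=
    (hasDerivAt_inv hr').comp_ofReal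
  refine (h1.fun_pow j).congr_deriv ?_
  cases j with
  | zero => simp
  | succ j =>
    simp
    field_simp
    ring

theorem hasDerivAt_hankelPoly (k : ℝ) (n : ℕ) {r : ℝ} (hr : r ≠ 0) :
    HasDerivAt (hankelPoly k n) (hankelPolyDeriv k n r) r := by
  unfold hankelPoly hankelPolyDeriv
  exact HasDerivAt.fun_sum fun j _ => (hasDerivAt_inv_pow hr j).const_mul _

/-- This is P'' + 2ik P' = n(n+1) P / r², the equation left for P after e^{ikr} is divided out of
the Riccati–Bessel equation. -/
theorem hasDerivAt_hankelPolyDeriv {k : ℝ} (hk : k ≠ 0) (n : ℕ) {r : ℝ} (hr : r ≠ 0) :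
    HasDerivAt (hankelPolyDeriv k n)
      (n * (n + 1) / (r : ℂ) ^ 2 * hankelPoly k n r
        - 2 * Complex.I * k * hankelPolyDeriv k n r) r := by
  have h : HasDerivAt (hankelPolyDeriv k n) (∑ j ∈ Finset.range (n + 1),
      hankelCoeff k n j * (-j * (-(j + 1 : ℕ) * (r : ℂ)⁻¹ ^ (j + 1 + 1)))) r := by
    unfold hankelPolyDeriv
    exact HasDerivAt.fun_sum fun j _ => ((hasDerivAt_inv_pow hr (j + 1)).const_mul _).const_mul _
  refine h.congr_deriv ?_
  -- By the recursion the defect in the equation telescopes; the lower end vanishes through the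
  -- factor j = 0, the upper one through the vanishing of the coefficient n + 1.
  have ht := Finset.sum_range_sub
    (fun j : ℕ => 2 * Complex.I * k * j * hankelCoeff k n j * (r : ℂ)⁻¹ ^ (j + 1)) (n + 1)
  simp only [hankelCoeff_self_succ, Nat.cast_zero, mul_zero, zero_mul, sub_zero] at ht
  rw [← sub_eq_zero, ← ht, hankelPoly, hankelPolyDeriv, Finset.mul_sum, Finset.mul_sum,
    ← Finset.sum_sub_distrib, ← Finset.sum_sub_distrib]
  refine Finset.sum_congr rfl fun j _ => ?_
  have hc := hankelCoeff_succ_mul hk n j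
  push_cast
  rw [div_eq_mul_inv, ← inv_pow]
  linear_combination (-(r : ℂ)⁻¹ ^ (j + 2)) * hc

theorem hasDerivAt_exp_I_mul (k r : ℝ) :
    HasDerivAt (fun r : ℝ => Complex.exp (Complex.I * k * r))
      (Complex.exp (Complex.I * k * r) * (Complex.I * k)) r := by
  have h : HasDerivAt (fun z : ℂ => Complex.exp (Complex.I * k * z))
      (Complex.exp (Complex.I * k * r) * (Complex.I * k)) r := by
    simpa using ((hasDerivAt_id (r : ℂ)).const_mul (Complex.I * k)).cexp
  exact h.comp_ofReal

/-! ### Outgoing solutions and their Wronskians -/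

/-- `v`, with derivative `v'`, solves the Riccati–Bessel equation on `(R, ∞)`, is outgoing, and is
asymptotic to `a * exp (i k r)`. -/
structure IsOutgoing (k : ℝ) (n : ℕ) (R : ℝ) (v v' : ℝ → ℂ) (a : ℂ) : Prop where
  hasDerivAt : ∀ r, R < r → HasDerivAt v (v' r) r
  hasDerivAt_deriv : ∀ r, R < r →
    HasDerivAt v' ((n * (n + 1) / (r : ℂ) ^ 2 - (k : ℂ) ^ 2) * v r) r
  tendsto : Tendsto (fun r : ℝ => Complex.exp (-(Complex.I * k * r)) * v r) atTop (𝓝 a)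
  radiation : Tendsto (fun r : ℝ => Complex.exp (-(Complex.I * k * r)) *
    (v' r - Complex.I * k * v r)) atTop (𝓝 0)

theorem tendsto_ofReal_inv_pow_succ (j : ℕ) :
    Tendsto (fun r : ℝ => (r : ℂ)⁻¹ ^ (j + 1)) atTop (𝓝 0) := by
  have h1 : Tendsto (fun r : ℝ => (r : ℂ)⁻¹) atTop (𝓝 0) := by
    have := (Complex.continuous_ofReal.tendsto 0).comp (tendsto_inv_atTop_zero (𝕜 := ℝ))
    simpa [Function.comp_def] using this
  simpa using h1.pow (j + 1)

theorem tendsto_hankelPoly (k : ℝ) (n : ℕ) : Tendsto (hankelPoly k n) atTop (𝓝 1) := by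
  unfold hankelPoly
  simp only [Finset.sum_range_succ', pow_zero, mul_one]
  have : Tendsto (fun r : ℝ => ∑ j ∈ Finset.range n, hankelCoeff k n (j + 1) * (r : ℂ)⁻¹ ^ (j + 1))
      atTop (𝓝 (∑ j ∈ Finset.range n, hankelCoeff k n (j + 1) * 0)) :=
    tendsto_finsetSum _ fun j _ => (tendsto_ofReal_inv_pow_succ j).const_mul _
  simpa [hankelCoeff] using this.add_const (hankelCoeff k n 0)

theorem tendsto_hankelPolyDeriv (k : ℝ) (n : ℕ) : Tendsto (hankelPolyDeriv k n) atTop (𝓝 0) := by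
  unfold hankelPolyDeriv
  have : Tendsto (fun r : ℝ => ∑ j ∈ Finset.range (n + 1),
      hankelCoeff k n j * (-j * (r : ℂ)⁻¹ ^ (j + 1)))
      atTop (𝓝 (∑ j ∈ Finset.range (n + 1), hankelCoeff k n j * (-j * 0))) :=
    tendsto_finsetSum _ fun j _ => ((tendsto_ofReal_inv_pow_succ j).const_mul _).const_mul _
  simpa using this

theorem exp_neg_mul_exp_mul (z w : ℂ) : Complex.exp (-z) * (Complex.exp z * w) = w := by
  rw [← mul_assoc, ← Complex.exp_add]; simp

theorem isOutgoing_riccatiHankel {k : ℝ} (hk : k ≠ 0) (n : ℕ) {R : ℝ} (hR : 0 ≤ R) :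
    IsOutgoing k n R (riccatiHankel k n) (riccatiHankelDeriv k n) 1 where
  hasDerivAt r hr := by
    refine ((hasDerivAt_exp_I_mul k r).mul
      (hasDerivAt_hankelPoly k n (hR.trans_lt hr).ne')).congr_deriv ?_
    rw [riccatiHankelDeriv]; ring
  hasDerivAt_deriv r hr := by
    have hr0 := (hR.trans_lt hr).ne'
    refine ((hasDerivAt_exp_I_mul k r).mul
      (((hasDerivAt_hankelPoly k n hr0).const_mul (Complex.I * k)).add
        (hasDerivAt_hankelPolyDeriv hk n hr0))).congr_deriv ?_
    rw [riccatiHankel]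
    simp only [Pi.add_apply]
    linear_combination (Complex.exp (Complex.I * k * r) * k ^ 2 * hankelPoly k n r) * Complex.I_sq
  tendsto := by
    simpa only [riccatiHankel, exp_neg_mul_exp_mul] using tendsto_hankelPoly k n
  radiation := by
    convert tendsto_hankelPolyDeriv k n using 2 with r
    rw [riccatiHankel, riccatiHankelDeriv]
    linear_combination exp_neg_mul_exp_mul (Complex.I * k * r) (hankelPolyDeriv k n r)

/-- The Wronskian of two solutions of `f'' = q f` is constant, hence equal to its limit. -/
theorem wronskian_eq_of_tendsto {R : ℝ} {f f' g g' q : ℝ → ℂ} {L : ℂ}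
    (hf : ∀ r, R < r → HasDerivAt f (f' r) r) (hf' : ∀ r, R < r → HasDerivAt f' (q r * f r) r)
    (hg : ∀ r, R < r → HasDerivAt g (g' r) r) (hg' : ∀ r, R < r → HasDerivAt g' (q r * g r) r)
    (hL : Tendsto (fun r => f r * g' r - f' r * g r) atTop (𝓝 L)) {r : ℝ} (hr : R < r) :
    f r * g' r - f' r * g r = L := by
  have hd : ∀ t ∈ Set.Ioi R, HasDerivAt (fun r => f r * g' r - f' r * g r) 0 t := by
    intro t ht
    refine (((hf t ht).mul (hg' t ht)).sub ((hf' t ht).mul (hg t ht))).congr_deriv ?_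
    ring
  have hc : ∀ t ∈ Set.Ioi R, f t * g' t - f' t * g t = f r * g' r - f' r * g r := fun t ht =>
    isOpen_Ioi.is_const_of_deriv_eq_zero isPreconnected_Ioi
      (fun t ht => (hd t ht).differentiableAt.differentiableWithinAt)
      (fun t ht => (hd t ht).deriv) ht hr
  refine tendsto_nhds_unique (tendsto_const_nhds.congr' ?_) hL
  filter_upwards [Ioi_mem_atTop R] with t ht using (hc t ht).symm

theorem tendsto_exp_mul_zero {k c : ℝ} {f : ℝ → ℂ} (hf : Tendsto f atTop (𝓝 0)) :
    Tendsto (fun r : ℝ => Complex.exp (Complex.I * (c * k * r)) * f r) atTop (𝓝 0) := by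
  rw [tendsto_zero_iff_norm_tendsto_zero] at hf ⊢
  convert hf using 2 with r
  rw [norm_mul, mul_comm Complex.I]
  have := Complex.norm_exp_ofReal_mul_I (c * k * r)
  push_cast at this
  rw [this, one_mul]

/-- Replacing v' and H' by v' - ikv and H' - ikH leaves the Wronskian unchanged, and these radiation
defects tend to 0. -/
theorem IsOutgoing.wronskian_riccatiHankel {k : ℝ} (hk : k ≠ 0) {n : ℕ} {R : ℝ} (hR : 0 ≤ R)
    {v v' : ℝ → ℂ} {a : ℂ} (hv : IsOutgoing k n R v v' a) {r : ℝ} (hr : R < r) :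
    v r * riccatiHankelDeriv k n r - v' r * riccatiHankel k n r = 0 := by
  have hH := isOutgoing_riccatiHankel hk n hR
  refine wronskian_eq_of_tendsto hv.hasDerivAt hv.hasDerivAt_deriv hH.hasDerivAt
    hH.hasDerivAt_deriv ?_ hr
  -- The limits are stated for functions multiplied by e^{-ikr}; a product of two needs the
  -- unimodular factor e^{2ikr} back.
  have h := tendsto_exp_mul_zero (k := k) (c := 2) (by
    simpa using (hv.tendsto.mul hH.radiation).sub (hv.radiation.mul hH.tendsto))
  refine h.congr fun r => ?_
  have he : Complex.exp (Complex.I * ((2 : ℝ) * k * r)) * Complex.exp (-(Complex.I * k * r)) ^ 2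
      = 1 := by
    rw [← Complex.exp_nat_mul, ← Complex.exp_add, ← Complex.exp_zero]
    congr 1
    push_cast
    ring
  linear_combination (v r * riccatiHankelDeriv k n r - v' r * riccatiHankel k n r) * he

theorem conj_exp_I_mul (k r : ℝ) :
    conj (Complex.exp (Complex.I * k * r)) = Complex.exp (-(Complex.I * k * r)) := by
  rw [← Complex.exp_conj]
  simp

/-- The conjugate of H solves the same equation, whose coefficients are real, but is incoming: its
derivative is about -ik times itself while v' is about ikv. The oscillations cancel and the limit is
-2ika. -/
theorem IsOutgoing.wronskian_conj_riccatiHankel {k : ℝ} (hk : k ≠ 0) {n : ℕ} {R : ℝ} (hR : 0 ≤ R)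
    {v v' : ℝ → ℂ} {a : ℂ} (hv : IsOutgoing k n R v v' a) {r : ℝ} (hr : R < r) :
    v r * conj (riccatiHankelDeriv k n r) - v' r * conj (riccatiHankel k n r) =
      -2 * Complex.I * k * a := by
  have hH := isOutgoing_riccatiHankel hk n hR
  refine wronskian_eq_of_tendsto (g := fun r => conj (riccatiHankel k n r))
    (g' := fun r => conj (riccatiHankelDeriv k n r)) hv.hasDerivAt hv.hasDerivAt_deriv
    (fun r hr => (hH.hasDerivAt r hr).star) (fun r hr => ?_) ?_ hr
  · refine (hH.hasDerivAt_deriv r hr).star.congr_deriv ?_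
    simp
  · have hP : Tendsto (fun r => conj (hankelPoly k n r)) atTop (𝓝 1) := by
      simpa [Function.comp_def] using (Complex.continuous_conj.tendsto _).comp (tendsto_hankelPoly k n)
    have hP' : Tendsto (fun r => conj (hankelPolyDeriv k n r)) atTop (𝓝 0) := by
      simpa [Function.comp_def] using (Complex.continuous_conj.tendsto _).comp (tendsto_hankelPolyDeriv k n)
    have h := (hv.tendsto.mul ((hP.const_mul (-2 * Complex.I * k)).add hP')).sub
      (hv.radiation.mul hP)
    have e : a * (-2 * Complex.I * k * 1 + 0) - 0 * 1 = -2 * Complex.I * k * a := by ring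
    rw [e] at h
    refine h.congr fun r => ?_
    simp only [riccatiHankel, riccatiHankelDeriv, map_mul, map_add, conj_exp_I_mul,
      Complex.conj_I, Complex.conj_ofReal]
    ring

/-- An outgoing solution is a multiple of the Riccati–Hankel function. -/
theorem IsOutgoing.eq_mul_riccatiHankel {k : ℝ} (hk : k ≠ 0) {n : ℕ} {R : ℝ} (hR : 0 ≤ R)
    {v v' : ℝ → ℂ} {a : ℂ} (hv : IsOutgoing k n R v v' a) {r : ℝ} (hr : R < r) :
    v r = a * riccatiHankel k n r := by
  have h1 := hv.wronskian_riccatiHankel hk hR hr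
  have h2 := hv.wronskian_conj_riccatiHankel hk hR hr
  have h3 := (isOutgoing_riccatiHankel hk n hR).wronskian_conj_riccatiHankel hk hR hr
  have hk' : (-2 * Complex.I * k : ℂ) ≠ 0 := by simp [hk]
  apply mul_left_cancel₀ hk'
  -- Eliminating v' from `h1` and `h2` leaves v times the Wronskian of H and its conjugate, which
  -- `h3` evaluates as the nonzero constant -2ik.
  linear_combination riccatiHankel k n r * h2 - conj (riccatiHankel k n r) * h1 - v r * h3

/-! ### Continuity and size of the Riccati–Hankel functions -/

theorem continuousOn_riccatiHankel (k : ℝ) (n : ℕ) :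
    ContinuousOn (riccatiHankel k n) (Set.Ioi 0) := by
  intro r hr
  exact ((hasDerivAt_exp_I_mul k r).mul
    (hasDerivAt_hankelPoly k n (ne_of_gt hr))).continuousAt.continuousWithinAt

/-- For j ≤ n the numerator of the recursion is at most n(n+1) in modulus, so the coefficients are
dominated by those of an exponential series. -/
theorem norm_hankelCoeff_le {k : ℝ} (hk : 0 < k) {n j : ℕ} (hj : j ≤ n) :
    ‖hankelCoeff k n j‖ ≤ ((n * (n + 1)) / (2 * k)) ^ j / j.factorial := by
  induction j with
  | zero => simp [hankelCoeff]
  | succ j ih =>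
    have hjn : (j : ℝ) ≤ n := by exact_mod_cast (Nat.le_of_succ_le hj)
    have h1 : ‖((j * (j + 1) - n * (n + 1)) / (2 * Complex.I * k * (j + 1)) : ℂ)‖ ≤
        (n * (n + 1)) / (2 * k) / (j + 1) := by
      have e1 : ((j * (j + 1) - n * (n + 1) : ℂ)) = ((j * (j + 1) - n * (n + 1) : ℝ) : ℂ) := by
        push_cast; ring
      have e2 : ((j : ℂ) + 1) = ((j + 1 : ℝ) : ℂ) := by push_cast; ring
      rw [norm_div, e1, e2]
      simp only [norm_mul, Complex.norm_I, Complex.norm_real, Complex.norm_ofNat, mul_one,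
        Real.norm_eq_abs]
      rw [abs_of_pos hk, abs_of_pos (by positivity : (0 : ℝ) < j + 1), div_div]
      gcongr
      rw [abs_le]
      constructor <;> nlinarith [(Nat.cast_nonneg j : (0 : ℝ) ≤ j)]
    rw [hankelCoeff, norm_mul]
    calc _ ≤ ((n * (n + 1)) / (2 * k)) ^ j / j.factorial * ((n * (n + 1)) / (2 * k) / (j + 1)) :=
          mul_le_mul (ih (Nat.le_of_succ_le hj)) h1 (norm_nonneg _) (by positivity)
      _ = _ := by
          rw [Nat.factorial_succ, pow_succ]
          push_cast
          field_simp

/-- The polynomial is bounded by a partial sum of exp(n(n+1)/(2kr)); squaring doubles the exponent.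
-/
theorem norm_riccatiHankel_sq_le {k : ℝ} (hk : 0 < k) (n : ℕ) {r : ℝ} (hr : 0 < r) :
    ‖riccatiHankel k n r‖ ^ 2 ≤ Real.exp (n * (n + 1) / (k * r)) := by
  have h1 : ‖riccatiHankel k n r‖ ≤ Real.exp (n * (n + 1) / (2 * k * r)) := by
    have he : ‖Complex.exp (Complex.I * k * r)‖ = 1 := by
      have := Complex.norm_exp_ofReal_mul_I (k * r)
      rwa [mul_comm, Complex.ofReal_mul, ← mul_assoc] at this
    rw [riccatiHankel, norm_mul, he, one_mul, hankelPoly]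
    calc _ ≤ ∑ j ∈ Finset.range (n + 1), (n * (n + 1) / (2 * k * r)) ^ j / j.factorial := by
          refine norm_sum_le_of_le _ fun j hj => ?_
          rw [norm_mul, norm_pow, norm_inv, Complex.norm_real, Real.norm_eq_abs, abs_of_pos hr]
          calc _ ≤ ((n * (n + 1)) / (2 * k)) ^ j / j.factorial * r⁻¹ ^ j :=
                mul_le_mul_of_nonneg_right (norm_hankelCoeff_le hk
                  (Nat.lt_succ_iff.1 (Finset.mem_range.1 hj))) (by positivity)
            _ = _ := by
                rw [← div_div _ (2 * k) r, div_eq_mul_inv _ r, mul_pow]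
                ring
      _ ≤ _ := Real.sum_le_exp_of_nonneg (by positivity) _
  calc _ ≤ Real.exp (n * (n + 1) / (2 * k * r)) ^ 2 := by gcongr
    _ = _ := by
      rw [← Real.exp_nat_mul]
      congr 1
      push_cast
      field_simp

/-! ### Limits at infinity and at the boundary sphere -/

theorem tendsto_integral_mul_of_tendstoUniformly {F : ℝ → S2 → ℂ} {f g : S2 → ℂ}
    (hF : ∀ᶠ r in atTop, Continuous (F r)) (h : TendstoUniformly F f atTop) (hg : Continuous g) :
    Tendsto (fun r => ∫ σ, F r σ * g σ ∂surf) atTop (𝓝 (∫ σ, f σ * g σ ∂surf)) := by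
  -- Continuity of the limit, which will be A, is inherited from uniform convergence rather than
  -- assumed.
  have hf : Continuous f := h.continuous hF.frequently
  have hb : TendstoUniformlyOn (fun r σ => F r σ * g σ) (fun σ => f σ * g σ) atTop Set.univ := by
    obtain ⟨C, hC⟩ := isCompact_univ.exists_bound_of_continuousOn (hg.continuousOn (s := Set.univ))
    have hC' : 0 < |C| + 1 := by positivity
    rw [Metric.tendstoUniformlyOn_iff]
    intro ε hε
    filter_upwards [Metric.tendstoUniformly_iff.1 h (ε / (|C| + 1)) (by positivity)] with r hr σ _
    rw [dist_eq_norm, ← sub_mul, norm_mul, ← dist_eq_norm]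
    have h1 : ‖g σ‖ < |C| + 1 := ((hC σ trivial).trans (le_abs_self C)).trans_lt (by linarith)
    calc dist (f σ) (F r σ) * ‖g σ‖ ≤ dist (f σ) (F r σ) * (|C| + 1) := by gcongr
      _ < ε / (|C| + 1) * (|C| + 1) := by gcongr; exact hr σ
      _ = ε := by field_simp
  refine tendsto_integral_filter_of_norm_le_const ?_ ?_ ?_
  · filter_upwards [hF] with r hr using (hr.mul hg).aestronglyMeasurable
  · obtain ⟨C, hC⟩ := isCompact_univ.exists_bound_of_continuousOn
      ((hf.mul hg).continuousOn (s := Set.univ))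
    refine ⟨C + 1, ?_⟩
    filter_upwards [Metric.tendstoUniformlyOn_iff.1 hb 1 one_pos] with r hr
    refine Eventually.of_forall fun σ => ?_
    have h1 := (hr σ trivial).le
    rw [dist_comm, dist_eq_norm] at h1
    calc ‖F r σ * g σ‖ = ‖(F r σ * g σ - f σ * g σ) + f σ * g σ‖ := by rw [sub_add_cancel]
      _ ≤ _ := norm_add_le _ _
      _ ≤ C + 1 := by linarith [show ‖f σ * g σ‖ ≤ C from hC σ trivial]
  · exact Eventually.of_forall fun σ => hb.tendsto_at (Set.mem_univ σ)

theorem IsScatteringAmplitude.tendstoUniformly {k : ℝ} {u : E3 → ℂ} {A : S2 → ℂ}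
    (hA : IsScatteringAmplitude k u A) :
    TendstoUniformly (fun (r : ℝ) (σ : S2) =>
      Complex.exp (-(Complex.I * k * r)) * r * u (r • (σ : E3))) A atTop := by
  obtain ⟨C, ρ, hρ, h⟩ := hA
  rw [Metric.tendstoUniformly_iff]
  intro ε hε
  have h0 : Tendsto (fun r : ℝ => C / r) atTop (𝓝 0) := tendsto_const_nhds.div_atTop tendsto_id
  filter_upwards [eventually_ge_atTop ρ, h0.eventually_lt_const hε] with r hr hrε σ
  have hr0 : 0 < r := hρ.trans_le hr
  have hrc : (r : ℂ) ≠ 0 := by exact_mod_cast hr0.ne'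
  refine lt_of_le_of_lt ?_ hrε
  have e : Complex.exp (-(Complex.I * k * r)) * r * u (r • (σ : E3)) - A σ =
      Complex.exp (-(Complex.I * k * r)) * r *
        (u (r • (σ : E3)) - Complex.exp (Complex.I * k * r) / r * A σ) := by
    have := exp_neg_mul_exp_mul (Complex.I * k * r) (A σ)
    field_simp
    linear_combination this
  have hn : ‖Complex.exp (-(Complex.I * k * r))‖ = 1 := by
    have := Complex.norm_exp_ofReal_mul_I (-(k * r))
    rw [← this]
    congr 2
    push_cast
    ring
  rw [dist_comm, dist_eq_norm, e, norm_mul, norm_mul, hn, one_mul, Complex.norm_real,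
    Real.norm_eq_abs, abs_of_pos hr0]
  calc _ ≤ r * (C / r ^ 2) := by gcongr; exact h r hr σ
    _ = C / r := by field_simp

theorem IsRadiatingSolution.tendstoUniformly {k R : ℝ} {u : E3 → ℂ}
    (hu : IsRadiatingSolution k R u) :
    TendstoUniformly (fun (r : ℝ) (σ : S2) =>
      (r : ℂ) * (fderiv ℝ u (r • (σ : E3)) σ - Complex.I * k * u (r • (σ : E3))))
      (fun _ => 0) atTop := by
  rw [Metric.tendstoUniformly_iff]
  intro ε hε
  have h := hu.sommerfeld.eventually (Metric.ball_mem_nhds (0 : ℂ) hε)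
  rw [← comap_norm_atTop, eventually_comap] at h
  filter_upwards [h, eventually_gt_atTop 0] with r hr hr0 σ
  have h1 := hr (r • (σ : E3)) (norm_smul_coe_sphere hr0.le σ)
  rw [norm_smul_coe_sphere hr0.le, smul_smul, inv_mul_cancel₀ hr0.ne', one_smul] at h1
  rw [dist_comm]
  exact h1

section coefficients

variable {k R : ℝ} {u : E3 → ℂ} {A g : S2 → ℂ} {n : ℕ}

/-- The factor r removes the first-order term of the spherical Bessel equation. -/
theorem IsRadiatingSolution.isOutgoing (hR : 0 ≤ R) (hu : IsRadiatingSolution k R u)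
    (hA : IsScatteringAmplitude k u A) (hg : IsSphericalHarmonic n g) :
    IsOutgoing k n R (fun r => r * ∫ σ : S2, u (r • (σ : E3)) * g σ ∂surf)
      (fun r => (∫ σ : S2, u (r • (σ : E3)) * g σ ∂surf) +
        r * ∫ σ : S2, fderiv ℝ u (r • (σ : E3)) σ * g σ ∂surf)
      (∫ σ, A σ * g σ ∂surf) := by
  have hgc := hg.continuous
  have hu1 : ContDiffOn ℝ 1 u {x | R < ‖x‖} := hu.contDiffOn.of_le one_le_two
  have hdu : ContinuousOn (fderiv ℝ u) {x | R < ‖x‖} :=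
    hu1.continuousOn_fderiv_of_isOpen (isOpen_exterior R) le_rfl
  have hid : ∀ r : ℝ, HasDerivAt (fun r : ℝ => (r : ℂ)) 1 r := fun r =>
    Complex.ofRealCLM.hasDerivAt
  have hamp : Tendsto (fun r : ℝ => Complex.exp (-(Complex.I * k * r)) *
      (r * ∫ σ : S2, u (r • (σ : E3)) * g σ ∂surf)) atTop (𝓝 (∫ σ, A σ * g σ ∂surf)) := by
    refine (tendsto_integral_mul_of_tendstoUniformly ?_ hA.tendstoUniformly hgc).congr fun r => ?_
    · filter_upwards [eventually_gt_atTop R] with r hr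
      exact (hu1.continuousOn.comp_smul_sphere hR hr).const_mul _
    · rw [← mul_assoc, ← integral_const_mul]
      congr 1
      ext σ
      ring
  refine ⟨fun r hr => ?_, fun r hr => ?_, hamp, ?_⟩
  · refine ((hid r).mul (hasDerivAt_radialCoeff hR hr hu1 hgc)).congr_deriv ?_
    rw [one_mul]
  · have hr0 : (r : ℂ) ≠ 0 := by exact_mod_cast (hR.trans_lt hr).ne'
    refine ((hasDerivAt_radialCoeff hR hr hu1 hgc).add
      ((hid r).mul (hasDerivAt_radialCoeff_deriv hR hr hu.contDiffOn hgc))).congr_deriv ?_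
    have h := radialCoeff_ode hR hr hu.contDiffOn hu.helmholtz hg
    apply mul_left_cancel₀ hr0
    rw [show ((n * (n + 1) / (r : ℂ) ^ 2 - (k : ℂ) ^ 2) *
      ((r : ℂ) * ∫ σ : S2, u (r • (σ : E3)) * g σ ∂surf)) =
      (r : ℂ)⁻¹ * ((n * (n + 1) - (k : ℂ) ^ 2 * r ^ 2) * ∫ σ : S2, u (r • (σ : E3)) * g σ ∂surf) by
        field_simp, mul_inv_cancel_left₀ hr0]
    linear_combination h
  · have h1 : Tendsto (fun r : ℝ => (r : ℂ) *
        ((∫ σ : S2, fderiv ℝ u (r • (σ : E3)) σ * g σ ∂surf) -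
          Complex.I * k * ∫ σ : S2, u (r • (σ : E3)) * g σ ∂surf)) atTop (𝓝 0) := by
      have := tendsto_integral_mul_of_tendstoUniformly ?_ hu.tendstoUniformly hgc
      · simp only [zero_mul, integral_zero] at this
        refine this.congr' ?_
        filter_upwards [eventually_gt_atTop R] with r hr
        have i0 : Integrable (fun σ : S2 => u (r • (σ : E3)) * g σ) surf :=
          ((hu1.continuousOn.comp_smul_sphere hR hr).mul hgc).integrable_surf
        have i1 : Integrable (fun σ : S2 => fderiv ℝ u (r • (σ : E3)) σ * g σ) surf :=
          (((hdu.comp_smul_sphere hR hr).clm_apply (by fun_prop)).mul hgc).integrable_surf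
        rw [← integral_const_mul (Complex.I * k), ← integral_sub i1 (i0.const_mul _),
          ← integral_const_mul]
        congr 1
        ext σ
        ring
      · filter_upwards [eventually_gt_atTop R] with r hr
        exact (((hdu.comp_smul_sphere hR hr).clm_apply (by fun_prop)).sub
          ((hu1.continuousOn.comp_smul_sphere hR hr).const_mul _)).const_mul _
    -- With c(r) the coefficient, v' - ikv = c + r(c' - ikc). The second part is Sommerfeld's
    -- condition; c itself tends to 0 because e^{-ikr} r c converges.
    have h2 : Tendsto (fun r : ℝ => ∫ σ : S2, u (r • (σ : E3)) * g σ ∂surf) atTop (𝓝 0) := by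
      have h3 := (tendsto_ofReal_inv_pow_succ 0).mul hamp
      rw [zero_mul] at h3
      refine (tendsto_exp_mul_zero (k := k) (c := 1) h3).congr' ?_
      filter_upwards [eventually_gt_atTop 0] with r hr
      have hr0 : (r : ℂ) ≠ 0 := by exact_mod_cast hr.ne'
      have he := exp_neg_mul_exp_mul (Complex.I * k * r)
        (∫ σ : S2, u (r • (σ : E3)) * g σ ∂surf)
      rw [← mul_assoc Complex.I]
      push_cast
      rw [one_mul]
      field_simp
      linear_combination he
    have h3 := tendsto_exp_mul_zero (k := k) (c := -1) (by simpa using h2.add h1)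
    refine h3.congr fun r => ?_
    have e : Complex.I * ((-1 : ℝ) * k * r) = -(Complex.I * k * r) := by push_cast; ring
    rw [e]
    ring

/-- By Cauchy–Schwarz, L² convergence of the boundary values gives L¹ convergence of their products
with g. -/
theorem tendsto_radialCoeff_boundary (hR : 0 ≤ R) (hu : ContinuousOn u {x | R < ‖x‖})
    (hb : HasL2BoundaryValues R u) (hg : Continuous g) :
    Tendsto (fun r : ℝ => ∫ σ : S2, u (r • (σ : E3)) * g σ ∂surf) (𝓝[>] R)
      (𝓝 (∫ σ : S2, u (R • (σ : E3)) * g σ ∂surf)) := by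
  have hg2 : MemLp g 2 surf := hg.memLp_of_hasCompactSupport (HasCompactSupport.of_compactSpace _)
  have hi : Integrable (fun σ : S2 => u (R • (σ : E3)) * g σ) surf := hb.memLp.integrable_mul hg2
  refine tendsto_integral_of_L1' _ hi.1 ?_ ?_
  · filter_upwards [self_mem_nhdsWithin] with r hr
    exact ((hu.comp_smul_sphere hR hr).mul hg).integrable_surf
  · have h := ENNReal.Tendsto.mul_const hb.tendsto (Or.inr hg2.2.ne) (b := eLpNorm g 2 surf)
    rw [zero_mul] at h
    refine tendsto_of_tendsto_of_tendsto_of_le_of_le' tendsto_const_nhds h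
      (Eventually.of_forall fun _ => zero_le) ?_
    filter_upwards [self_mem_nhdsWithin] with r hr
    have hm : AEStronglyMeasurable (fun σ : S2 => u (r • (σ : E3)) - u (R • (σ : E3))) surf :=
      (hu.comp_smul_sphere hR hr).aestronglyMeasurable.sub hb.memLp.1
    refine le_trans (le_of_eq ?_) (eLpNorm_smul_le_mul_eLpNorm (p := 2) (q := 2) (r := 1) hg2.1 hm)
    congr 1
    ext σ
    simp [sub_mul]

/-- The coefficients of the boundary values in terms of those of the scattering amplitude. -/
theorem IsRadiatingSolution.boundary_coeff (hk : k ≠ 0) (hR : 0 < R)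
    (hu : IsRadiatingSolution k R u) (hb : HasL2BoundaryValues R u)
    (hA : IsScatteringAmplitude k u A) (hg : IsSphericalHarmonic n g) :
    R * ∫ σ : S2, u (R • (σ : E3)) * g σ ∂surf =
      (∫ σ, A σ * g σ ∂surf) * riccatiHankel k n R := by
  have hout := hu.isOutgoing hR.le hA hg
  have h1 : Tendsto (fun r : ℝ => (r : ℂ) * ∫ σ : S2, u (r • (σ : E3)) * g σ ∂surf) (𝓝[>] R)
      (𝓝 (R * ∫ σ : S2, u (R • (σ : E3)) * g σ ∂surf)) :=
    ((Complex.continuous_ofReal.tendsto R).mono_left nhdsWithin_le_nhds).mul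
      (tendsto_radialCoeff_boundary hR.le hu.contDiffOn.continuousOn hb hg.continuous)
  have h2 : Tendsto (fun r : ℝ => (∫ σ, A σ * g σ ∂surf) * riccatiHankel k n r) (𝓝[>] R)
      (𝓝 ((∫ σ, A σ * g σ ∂surf) * riccatiHankel k n R)) :=
    (((continuousOn_riccatiHankel k n).continuousAt
      (Ioi_mem_nhds hR)).tendsto.mono_left nhdsWithin_le_nhds).const_mul _
  -- The identity holds for r > R only, where the equation does; both sides are carried to R by
  -- their limits.
  refine tendsto_nhds_unique h1 (h2.congr' ?_)
  filter_upwards [self_mem_nhdsWithin] with r hr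
  exact (hout.eq_mul_riccatiHankel hk hR.le hr).symm

/-- The Hankel factor depends on n but not on m, so it comes out of the sum over m. -/
theorem degreeSq_boundary {Y : (n : ℕ) → Fin (2 * n + 1) → S2 → ℂ} (hk : k ≠ 0) (hR : 0 < R)
    (hu : IsRadiatingSolution k R u) (hb : HasL2BoundaryValues R u)
    (hA : IsScatteringAmplitude k u A) (hY : ∀ n m, IsSphericalHarmonic n (Y n m)) (n : ℕ) :
    ENNReal.ofReal (R ^ 2) * degreeSq Y (fun σ => u (R • (σ : E3))) n =
      ‖riccatiHankel k n R‖ₑ ^ 2 * degreeSq Y A n := by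
  have hRe : ENNReal.ofReal (R ^ 2) = ‖(R : ℂ)‖ₑ ^ 2 := by
    rw [← ofReal_norm, Complex.norm_real, Real.norm_eq_abs, abs_of_pos hR,
      ENNReal.ofReal_pow hR.le]
  rw [degreeSq, degreeSq, hRe, Finset.mul_sum, Finset.mul_sum]
  refine Finset.sum_congr rfl fun m _ => ?_
  rw [← mul_pow, ← mul_pow, ← enorm_mul, ← enorm_mul,
    hu.boundary_coeff hk hR hb hA (hY n m).conj, mul_comm]

end coefficients

/-! ### Scalar inequalities for low and high degrees -/

/-- This is where the constants with π come from: a spare factor e^{-1/2} in the exponential bounds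
is at most 2/π. -/
theorem pi_le_two_mul_exp_half : Real.pi ≤ 2 * Real.exp (1 / 2) := by
  have := Real.quadratic_le_exp_of_nonneg (x := 1 / 2) (by norm_num)
  linarith [Real.pi_lt_d2]

theorem exp_le_of_sq_le {z : ℝ} {n : ℕ} (hz : 2 ≤ z) (hn : (n : ℝ) ^ 2 ≤ z) :
    Real.exp (n * (n + 1) / z) ≤ 2 * Real.exp 1 ^ 2 / Real.pi := by
  have h1 : (n * (n + 1) / z : ℝ) ≤ 3 / 2 := by
    rw [div_le_iff₀ (by linarith)]
    -- For n ≤ 1 the bound comes from z ≥ 2; for n ≥ 2 from n + 1 ≤ 3n/2 and n² ≤ z.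
    rcases Nat.lt_or_ge n 2 with h | h
    · interval_cases n <;> norm_num <;> linarith
    · have : (2 : ℝ) ≤ n := by exact_mod_cast h
      nlinarith
  calc _ ≤ Real.exp (3 / 2) := Real.exp_le_exp.2 h1
    _ ≤ _ := by
      rw [le_div_iff₀ Real.pi_pos]
      calc _ ≤ Real.exp (3 / 2) * (2 * Real.exp (1 / 2)) := by
            gcongr; exact pi_le_two_mul_exp_half
        _ = 2 * (Real.exp (3 / 2) * Real.exp (1 / 2)) := by ring
        _ = 2 * Real.exp 1 ^ 2 := by
            rw [← Real.exp_add, ← Real.exp_nat_mul]; norm_num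

theorem exp_mul_exp_neg_le {k R E : ℝ} {n : ℕ} (hR : 0 < R) (hkR : 2 ≤ k * R)
    (hn : k * R < (n : ℝ) ^ 2) (hE : 0 ≤ E) (h : R ^ 2 + (n : ℝ) ^ 2 ≤ E + k) :
    Real.exp (n * (n + 1) / (k * R)) * Real.exp (-E) ≤ 2 / Real.pi * Real.exp (2 / R) := by
  have hz : 0 < k * R := by linarith
  have hn2 : (2 : ℝ) ≤ n := by
    by_contra hlt
    have : n < 2 := by
      by_contra h'
      exact hlt (by exact_mod_cast not_lt.1 h')
    interval_cases n <;> norm_num at hn <;> linarith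
  -- Only the fraction 2/(kR) of E is spent. Its share of R² + n² dominates n(n+1)/(kR) + 1/2, since
  -- kR < n² and n ≤ n²/2, and its share of k costs 2/R.
  have hθ : 2 / (k * R) ≤ 1 := (div_le_one hz).2 hkR
  have h1 : 2 / (k * R) * (R ^ 2 + (n : ℝ) ^ 2 - k) ≤ E :=
    calc _ ≤ 2 / (k * R) * E := by gcongr; linarith
      _ ≤ 1 * E := by gcongr
      _ = E := one_mul E
  have h2 : 2 / (k * R) * (R ^ 2 + (n : ℝ) ^ 2 - k) =
      2 * (R ^ 2 + (n : ℝ) ^ 2) / (k * R) - 2 / R := by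
    have hk : k ≠ 0 := by rintro rfl; linarith
    field_simp
  have h3 : (n * (n + 1) / (k * R) : ℝ) + 1 / 2 ≤ 2 * (R ^ 2 + (n : ℝ) ^ 2) / (k * R) := by
    rw [le_div_iff₀ hz, add_mul, div_mul_cancel₀ _ hz.ne']
    nlinarith [sq_nonneg R]
  have h4 : (n * (n + 1) / (k * R) : ℝ) + -E ≤ 2 / R - 1 / 2 := by linarith
  rw [← Real.exp_add]
  calc _ ≤ Real.exp (2 / R - 1 / 2) := Real.exp_le_exp.2 h4
    _ = Real.exp (2 / R) / Real.exp (1 / 2) := Real.exp_sub _ _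
    _ ≤ _ := by
      rw [div_mul_eq_mul_div, div_le_div_iff₀ (Real.exp_pos _) Real.pi_pos]
      nlinarith [pi_le_two_mul_exp_half, Real.exp_pos (2 / R)]

/-! ### Splitting the sum over degrees -/

/-- T collects the degrees n > N where the growth h is absorbed by ε₂. It is returned with two
bounds because the two final estimates treat the same T differently. -/
theorem tsum_le_of_split {d α h : ℕ → ℝ≥0∞} {N : ℕ} {ρ c₁ c₂ ε₁ ε₂ F M z : ℝ≥0∞}
    (hd : ∀ n, ρ * d n = h n * α n) (hlow : ∀ n ≤ N, h n ≤ c₁)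
    (hhigh : ∀ n, N < n → ε₂ ≠ 0 → h n * ε₂ ≤ c₂ ∨ F ≤ ρ + (n : ℝ≥0∞) ^ 2)
    (hz : ∀ n, N < n → z ≤ (n : ℝ≥0∞) ^ 2)
    (hε₁ : ε₁ ^ 2 = ∑ n ∈ Finset.range (N + 1), α n) (hε₂ : ε₂ ^ 2 = ∑' n, α (N + 1 + n))
    (hε₂t : ε₂ ≠ ∞) (hF : F ≠ 0) (hFt : ε₂ ≠ 0 → F ≠ ∞)
    (hM : M = ∑' n : ℕ, (ρ + (n : ℝ≥0∞) ^ 2) * d n) :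
    ∃ T, ρ * ∑' n, d n ≤ c₁ * ε₁ ^ 2 + T + ρ * (M / F) ∧ T ≤ c₂ * ε₂ ∧ z * T ≤ ρ * M := by
  have hlowsum : ∑ n ∈ Finset.range (N + 1), ρ * d n ≤ c₁ * ε₁ ^ 2 := by
    rw [hε₁, Finset.mul_sum]
    refine Finset.sum_le_sum fun n hn => ?_
    rw [hd]
    gcongr
    exact hlow n (Nat.lt_succ_iff.1 (Finset.mem_range.1 hn))
  have hsplit : ρ * ∑' n, d n =
      ∑ n ∈ Finset.range (N + 1), ρ * d n + ∑' n, ρ * d (n + (N + 1)) := by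
    rw [← ENNReal.tsum_mul_left]
    exact (Summable.sum_add_tsum_nat_add' (f := fun n => ρ * d n) (k := N + 1)
      ENNReal.summable).symm
  have hshift : ∀ f : ℕ → ℝ≥0∞, ∑' n, f (n + (N + 1)) ≤ ∑' n, f n := fun f =>
    ENNReal.tsum_comp_le_tsum_of_injective (add_left_injective (N + 1)) f
  -- If ε₂ = 0, all amplitudes beyond N vanish, hence so does the tail of d, and T = 0 works.
  rcases eq_or_ne ε₂ 0 with h0 | h0
  · refine ⟨0, ?_, zero_le, by simp⟩
    have hα : ∀ n, α (N + 1 + n) = 0 := by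
      rw [h0, zero_pow two_ne_zero] at hε₂
      exact ENNReal.tsum_eq_zero.1 hε₂.symm
    have : ∑' n, ρ * d (n + (N + 1)) = 0 := by
      refine ENNReal.tsum_eq_zero.2 fun n => ?_
      rw [hd, add_comm n, hα, mul_zero]
    rw [hsplit, this, add_zero, add_zero]
    exact hlowsum.trans le_self_add
  classical
  let P : ℕ → Prop := fun n => h n * ε₂ ≤ c₂
  refine ⟨∑' n, if P (n + (N + 1)) then ρ * d (n + (N + 1)) else 0, ?_, ?_, ?_⟩
  · rw [hsplit, add_assoc]
    gcongr
    calc ∑' n, ρ * d (n + (N + 1))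
        = ∑' n, ((if P (n + (N + 1)) then ρ * d (n + (N + 1)) else 0) +
          (if P (n + (N + 1)) then 0 else ρ * d (n + (N + 1)))) := by
          refine tsum_congr fun n => ?_
          split_ifs <;> simp
      _ = _ := ENNReal.tsum_add
      _ ≤ _ := by
        gcongr
        rw [hM, div_eq_mul_inv, ← ENNReal.tsum_mul_right, ← ENNReal.tsum_mul_left]
        refine le_trans (ENNReal.tsum_le_tsum fun n => ?_)
          (hshift fun n : ℕ => ρ * ((ρ + (n : ℝ≥0∞) ^ 2) * d n * F⁻¹))
        split_ifs with hP
        · exact zero_le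
        · have hF' := (hhigh (n + (N + 1)) (by omega) h0).resolve_left hP
          calc ρ * d (n + (N + 1)) = ρ * (F * d (n + (N + 1)) * F⁻¹) := by
                rw [mul_right_comm, ENNReal.mul_inv_cancel hF (hFt h0), one_mul]
            _ ≤ _ := by gcongr
  · calc _ ≤ ∑' n, c₂ * ε₂⁻¹ * α (N + 1 + n) := by
          refine ENNReal.tsum_le_tsum fun n => ?_
          split_ifs with hP
          · rw [hd, add_comm n]
            gcongr
            rw [← div_eq_mul_inv, ENNReal.le_div_iff_mul_le (Or.inl h0) (Or.inl hε₂t), add_comm]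
            exact hP
          · exact zero_le
      _ = c₂ * ε₂ := by
          rw [ENNReal.tsum_mul_left, ← hε₂, pow_two, mul_assoc, ← mul_assoc ε₂⁻¹,
            ENNReal.inv_mul_cancel h0 hε₂t, one_mul]
  · rw [hM, ← ENNReal.tsum_mul_left, ← ENNReal.tsum_mul_left]
    refine le_trans (ENNReal.tsum_le_tsum fun n => ?_)
          (hshift fun n : ℕ => ρ * ((ρ + (n : ℝ≥0∞) ^ 2) * d n))
    split_ifs
    · rw [mul_left_comm]
      gcongr
      exact (hz _ (by omega)).trans le_add_self
    · simp

theorem ENNReal.rpow_half_sq (x : ℝ≥0∞) : (x ^ (1 / 2 : ℝ)) ^ 2 = x := by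
  rw [← ENNReal.rpow_natCast, ← ENNReal.rpow_mul]
  norm_num

theorem sphereNorm_zero_sq (Y : (n : ℕ) → Fin (2 * n + 1) → S2 → ℂ) (R : ℝ) (u : E3 → ℂ) :
    sphereNorm Y 0 R u ^ 2 =
      ENNReal.ofReal (R ^ 2) * ∑' n, degreeSq Y (fun σ => u (R • (σ : E3))) n := by
  rw [sphereNorm, ENNReal.rpow_half_sq]
  simp

theorem sphereNorm_one_sq (Y : (n : ℕ) → Fin (2 * n + 1) → S2 → ℂ) {R : ℝ} (hR : 0 < R)
    (u : E3 → ℂ) :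
    sphereNorm Y 1 R u ^ 2 = ∑' n : ℕ, (ENNReal.ofReal (R ^ 2) + (n : ℝ≥0∞) ^ 2) *
      degreeSq Y (fun σ => u (R • (σ : E3))) n := by
  rw [sphereNorm, ENNReal.rpow_half_sq, Finset.sum_range_succ, Finset.sum_range_one,
    ← ENNReal.tsum_add, ← ENNReal.tsum_mul_left]
  refine tsum_congr fun n => ?_
  have h : ENNReal.ofReal (R ^ 2) * ENNReal.ofReal ((n / R) ^ (2 * 1)) = (n : ℝ≥0∞) ^ 2 := by
    rw [← ENNReal.ofReal_mul (by positivity), ← ENNReal.ofReal_natCast,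
      ← ENNReal.ofReal_pow (by positivity)]
    congr 1
    rw [mul_one]
    field_simp
  rw [mul_add, ← mul_assoc, ← mul_assoc, h]
  simp [add_mul]

theorem negLog_ofReal {e : ℝ} (he : 0 < e) :
    negLog (ENNReal.ofReal e) = ENNReal.ofReal (-Real.log e) := by
  rw [negLog, ENNReal.log_ofReal_of_pos he, ← EReal.coe_neg, EReal.toENNReal_of_ne_top (by simp),
    EReal.toReal_coe]

theorem ENNReal.le_mul_rpow_half_of_le {T a b c M x z : ℝ≥0∞} (hz : z ≠ 0) (hzt : z ≠ ∞)
    (h1 : T ≤ a * x) (h2 : z * T ≤ b * M ^ 2) (hc : a * b / z = c ^ 2) :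
    T ≤ c * M * x ^ (1 / 2 : ℝ) := by
  have h3 : T ≤ b * M ^ 2 / z := by
    rwa [ENNReal.le_div_iff_mul_le (Or.inl hz) (Or.inl hzt), mul_comm]
  have h4 : T ^ 2 ≤ (c * M * x ^ (1 / 2 : ℝ)) ^ 2 := by
    calc T ^ 2 = T * T := sq T
      _ ≤ a * x * (b * M ^ 2 / z) := mul_le_mul' h1 h3
      _ = (a * b / z) * M ^ 2 * x := by simp only [div_eq_mul_inv]; ring
      _ = _ := by rw [hc, mul_pow, mul_pow, ENNReal.rpow_half_sq]
  exact (ENNReal.pow_le_pow_left_iff two_ne_zero).1 h4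

theorem theorem1p1 (k R : ℝ) (hR : 0 < R) (hkR : 2 ≤ k * R)
    (u : E3 → ℂ) (hu : IsRadiatingSolution k R u) (hb : HasL2BoundaryValues R u)
    (A : S2 → ℂ) (hA : IsScatteringAmplitude k u A)
    (Y : (n : ℕ) → Fin (2 * n + 1) → S2 → ℂ) (hY : IsSphericalHarmonicBasis Y)
    (N : ℕ) (hN : N = ⌊Real.sqrt (k * R)⌋₊)
    (ε₁ ε₂ E M₁ : ℝ≥0∞) (hε₁ : ε₁ = lowPart Y A N) (hε₂ : ε₂ = highPart Y A N)
    (hε₂_le : ε₂ ≤ 1) (hE : E = negLog ε₂) (hM₁ : M₁ = sphereNorm Y 1 R u) :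
    sphereNorm Y 0 R u ^ 2 ≤
        ENNReal.ofReal (2 * Real.exp 1 ^ 2 / Real.pi) * ε₁ ^ 2
          + ENNReal.ofReal (2 / Real.pi * Real.exp (2 / R)) * ε₂
          + ENNReal.ofReal (R ^ 2) * (M₁ ^ 2 / (E + ENNReal.ofReal k)) ∧
    sphereNorm Y 0 R u ^ 2 ≤
        ENNReal.ofReal (2 * Real.exp 1 ^ 2 / Real.pi) * ε₁ ^ 2
          + ENNReal.ofReal (Real.sqrt (2 * R / (Real.pi * k)) * Real.exp (1 / R)) * M₁
            * ε₂ ^ (1 / 2 : ℝ)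
          + ENNReal.ofReal (R ^ 2) * (M₁ ^ 2 / (E + ENNReal.ofReal k)) := by
  have hk : 0 < k := pos_of_mul_pos_left (by linarith) hR.le
  have hz : 0 < k * R := by linarith
  have hle : ∀ n, n ≤ N → (n : ℝ) ^ 2 ≤ k * R := fun n hn => by
    rw [hN, Nat.le_floor_iff (Real.sqrt_nonneg _)] at hn
    exact (Real.le_sqrt (Nat.cast_nonneg n) hz.le).1 hn
  have hlt : ∀ n, N < n → k * R < (n : ℝ) ^ 2 := fun n hn => by
    rw [hN, Nat.floor_lt (Real.sqrt_nonneg _)] at hn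
    exact (Real.sqrt_lt' (lt_of_le_of_lt (Real.sqrt_nonneg _) hn)).1 hn
  have hε₂t : ε₂ ≠ ∞ := ne_top_of_le_ne_top ENNReal.one_ne_top hε₂_le
  have hnorm : ∀ n, ‖riccatiHankel k n R‖ₑ ^ 2 ≤
      ENNReal.ofReal (Real.exp (n * (n + 1) / (k * R))) := fun n => by
    rw [← ofReal_norm, ← ENNReal.ofReal_pow (norm_nonneg _)]
    exact ENNReal.ofReal_le_ofReal (norm_riccatiHankel_sq_le hk n hR)
  have he : ε₂ ≠ 0 → ∃ e : ℝ, 0 < e ∧ e ≤ 1 ∧ ε₂ = ENNReal.ofReal e ∧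
      E = ENNReal.ofReal (-Real.log e) := fun h0 => by
    have hpos : 0 < ε₂.toReal := ENNReal.toReal_pos h0 hε₂t
    refine ⟨ε₂.toReal, hpos, ENNReal.toReal_mono ENNReal.one_ne_top hε₂_le,
      (ENNReal.ofReal_toReal hε₂t).symm, ?_⟩
    rw [← negLog_ofReal hpos, ENNReal.ofReal_toReal hε₂t, hE]
  have hnsq : ∀ n : ℕ, (n : ℝ≥0∞) ^ 2 = ENNReal.ofReal ((n : ℝ) ^ 2) := fun n => by
    rw [ENNReal.ofReal_pow (Nat.cast_nonneg n), ENNReal.ofReal_natCast]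
  have hhigh : ∀ n, N < n → ε₂ ≠ 0 → ‖riccatiHankel k n R‖ₑ ^ 2 * ε₂ ≤
      ENNReal.ofReal (2 / Real.pi * Real.exp (2 / R)) ∨
      E + ENNReal.ofReal k ≤ ENNReal.ofReal (R ^ 2) + (n : ℝ≥0∞) ^ 2 := by
    intro n hn h0
    obtain ⟨e, he0, he1, hee, hEe⟩ := he h0
    have hlog : 0 ≤ -Real.log e := neg_nonneg.2 (Real.log_nonpos he0.le he1)
    rw [hEe, ← ENNReal.ofReal_add hlog hk.le, hnsq,
      ← ENNReal.ofReal_add (by positivity) (by positivity), hee]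
    -- The threshold between the part controlled by ε₂ and the part controlled by M₁.
    rcases le_total (-Real.log e + k) (R ^ 2 + (n : ℝ) ^ 2) with h | h
    · exact Or.inr (ENNReal.ofReal_le_ofReal h)
    · left
      have := exp_mul_exp_neg_le hR hkR (hlt n hn) hlog h
      rw [neg_neg, Real.exp_log he0] at this
      calc _ ≤ ENNReal.ofReal (Real.exp (n * (n + 1) / (k * R))) * ENNReal.ofReal e := by
            gcongr
            exact hnorm n
        _ ≤ _ := by
            rw [← ENNReal.ofReal_mul (Real.exp_pos _).le]
            exact ENNReal.ofReal_le_ofReal this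
  obtain ⟨T, hT, hT1, hT2⟩ := tsum_le_of_split (N := N)
    (d := degreeSq Y fun σ => u (R • (σ : E3))) (α := degreeSq Y A)
    (h := fun n => ‖riccatiHankel k n R‖ₑ ^ 2) (ρ := ENNReal.ofReal (R ^ 2))
    (c₁ := ENNReal.ofReal (2 * Real.exp 1 ^ 2 / Real.pi))
    (c₂ := ENNReal.ofReal (2 / Real.pi * Real.exp (2 / R))) (ε₁ := ε₁) (ε₂ := ε₂)
    (F := E + ENNReal.ofReal k) (M := M₁ ^ 2) (z := ENNReal.ofReal (k * R))
    (degreeSq_boundary hk.ne' hR hu hb hA hY.harmonic)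
    (fun n hn => (hnorm n).trans (ENNReal.ofReal_le_ofReal (exp_le_of_sq_le hkR (hle n hn))))
    hhigh
    (fun n hn => by rw [hnsq]; exact ENNReal.ofReal_le_ofReal (hlt n hn).le)
    (by rw [hε₁, lowPart, ENNReal.rpow_half_sq]) (by rw [hε₂, highPart, ENNReal.rpow_half_sq])
    hε₂t (by simp [hk]) (fun h0 => by
      obtain ⟨e, -, -, -, hEe⟩ := he h0
      rw [hEe]
      finiteness) (by rw [hM₁, sphereNorm_one_sq Y hR])
  rw [sphereNorm_zero_sq]
  refine ⟨hT.trans (by gcongr), hT.trans ?_⟩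
  gcongr
  -- The constant is the root of (2/π)e^{2/R} · R²/(kR) = (2R/(πk)) e^{2/R}.
  refine ENNReal.le_mul_rpow_half_of_le (by simpa using hz) ENNReal.ofReal_ne_top hT1 hT2 ?_
  rw [← ENNReal.ofReal_mul (by positivity), ← ENNReal.ofReal_div_of_pos hz,
    ← ENNReal.ofReal_pow (by positivity)]
  congr 1
  rw [mul_pow, Real.sq_sqrt (by positivity), ← Real.exp_nat_mul,
    show ((2 : ℕ) : ℝ) * (1 / R) = 2 / R by push_cast; ring]
  field_simp
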